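/- Let $E_i=\mathbb{R}^{d_i}$, $i=1,\dots,n$, be Euclidean spaces, $E=\bigoplus_{i=1}^n E_i$ their orthogonal direct sum, and write $x=(x_1,\dots,x_n)$ for $x\in E$. Let $Q$ be a symmetric linear operator on $E$ and let $c_1,\dots,c_n>0$. Let $\mathcal{P}(E_i)$ be the set of Borel probability measures on $E_i$ that are absolutely continuous with respect to Lebesgue measure and have finite second moments. For $\mu_i\in\mathcal{P}(E_i)$ with density $\rho_i$ let $h(\mu_i)=-\int \log\rho_i\,d\mu_i\in[-\infty,\infty)$ be its Shannon entropy. Let $\pi(\mu_1,\dots,\mu_n)$ be the set of probability measures on $E$ with marginals $\mu_1,\dots,\mu_n$. A measure $\mu_i$ is symmetric if $\mu_i(-B)=\mu_i(B)$ for all Borel sets $B$, and log-concave if it has a log-concave density. **Theorem.** Let $D\in\mathbb{R}\cup\{+\infty\}$. The following statements are equivalent. (A) If even Borel functions $f_i:E_i\to\mathbb{R}\cup\{+\infty\}$, $i=1,\dots,n$, satisfy $e^{-f_i}\in L^1(E_i)$ and $$\sum_{i=1}^n c_i f_i(x_i)\ \ge\ \langle x,Qx\rangle\qquad\text{for all }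 x\in E,$$ then $$\prod_{i=1}^n\Big(\int_{E_i}e^{-f_i}\,dx_i\Big)^{c_i}\le e^{D}.$$ (B) If $\mu_i\in\mathcal{P}(E_i)$, $i=1,\dots,n$, are symmetric, then $$\sum_{i=1}^n c_i\,h(\mu_i)\ \le\ \sup_{\mu\in\pi(\mu_1,\dots,\mu_n)}\int_E\langle x,Qx\rangle\,d\mu(x)+D.$$ Moreover, there is a smallest constant $D_s(\mathbf{c},Q)\in\mathbb{R}\cup\{+\infty\}$ for which (B) holds, and log-concave measures saturate it: $D_s(\mathbf{c},Q)$ is also the smallest constant $D\in\mathbb{R}\cup\{+\infty\}$ for which the inequality in (B) holds for all symmetric log-concave $\mu_i\in\mathcal{P}(E_i)$, and there are symmetric log-concave $\mu_i^{(k)}\in\mathcal{P}(E_i)$, $k\ge 1$, with $$\lim_{k\to\infty}\Big(\sum_{i=1}^n c_i\,h(\mu_i^{(k)})-\sup_{\mu\in\pi(\mu_1^{(k)},\dots,\mu_n^{(k)})}\int_E\langle x,Qx\rangle\,d\mu\Big)=D_s(\mathbf{c},Q).$$ -/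

import Mathlib

open scoped ENNReal NNReal Topology
open MeasureTheory Filter

noncomputable section

namespace EntropicDuality

/-- The Euclidean space `E_i = ℝ^{d_i}`. -/
abbrev Factor {n : ℕ} (d : Fin n → ℕ) (i : Fin n) : Type :=
  EuclideanSpace ℝ (Fin (d i))

/-- The Euclidean (that is, `ℓ²`) direct sum `E = ⨁ i, E_i`; the projection `π_i` is `x ↦ x i`. -/
abbrev Total {n : ℕ} (d : Fin n → ℕ) : Type :=
  PiLp 2 (Factor d)

/-- `μ ∈ 𝓟(ℝ^m)`: a Borel probability measure, absolutely continuous with respect to Lebesgue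
measure, with finite second moment. -/
structure MemP {m : ℕ} (μ : Measure (EuclideanSpace ℝ (Fin m))) : Prop where
  isProbabilityMeasure : IsProbabilityMeasure μ
  absolutelyContinuous : μ ≪ volume
  secondMoment : Integrable (fun x => ‖x‖ ^ 2) μ

/-- The Shannon entropy `h(μ) = ∫ -log ρ dμ ∈ [-∞, ∞]`, where `ρ = dμ/dx`, as the integral of the
positive part of `-log ρ` minus the integral of its negative part. (Writing `ρ = e^{-f} / ∫ e^{-f}`
gives `h(μ) = log ∫ e^{-f} + ∫ f dμ`.) For `μ ∈ 𝓟(ℝ^m)` the first of the two integrals is finite,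
so that the difference is meaningful. -/
def entropy {m : ℕ} (μ : Measure (EuclideanSpace ℝ (Fin m))) : EReal :=
  ((∫⁻ x, ENNReal.ofReal (-Real.log (μ.rnDeriv volume x).toReal) ∂μ : ℝ≥0∞) : EReal) -
    ((∫⁻ x, ENNReal.ofReal (Real.log (μ.rnDeriv volume x).toReal) ∂μ : ℝ≥0∞) : EReal)

/-- `π(μ_1, …, μ_n)`: the probability measures on `E` with marginals `μ_1, …, μ_n`. -/
def couplings {n : ℕ} {d : Fin n → ℕ} (μ : ∀ i, Measure (Factor d i)) :
    Set (Measure (Total d)) :=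
  {γ | IsProbabilityMeasure γ ∧ ∀ i, γ.map (fun x => x i) = μ i}

/-- `sup ∫ ⟨x, Q x⟩ dγ` over all couplings `γ` of `μ_1, …, μ_n`. -/
def couplingSup {n : ℕ} {d : Fin n → ℕ} (Q : Total d →ₗ[ℝ] Total d)
    (μ : ∀ i, Measure (Factor d i)) : EReal :=
  ⨆ γ ∈ couplings μ, ((∫ x, inner ℝ x (Q x) ∂γ : ℝ) : EReal)

/-- The weighted entropy `∑ i, c_i h(μ_i)`. -/
def entropySum {n : ℕ} {d : Fin n → ℕ} (c : Fin n → ℝ)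
    (μ : ∀ i, Measure (Factor d i)) : EReal :=
  ∑ i, (c i : EReal) * entropy (μ i)

/-- The families `(μ_1, …, μ_n)` of symmetric measures in `𝓟(E_1), …, 𝓟(E_n)`. -/
def symmetricFamilies {n : ℕ} (d : Fin n → ℕ) : Set (∀ i, Measure (Factor d i)) :=
  {μ | ∀ i, MemP (μ i) ∧ (μ i).IsNegInvariant}

/-- A measure on `ℝ^m` is log-concave if it has a log-concave density `ρ : ℝ^m → [0, ∞)` with
respect to Lebesgue measure. -/
def IsLogConcave {m : ℕ} (μ : Measure (EuclideanSpace ℝ (Fin m))) : Prop :=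
  ∃ ρ : EuclideanSpace ℝ (Fin m) → ℝ≥0, Measurable ρ ∧
    (∀ x y, ∀ s t : ℝ, 0 < s → 0 < t → s + t = 1 →
      ρ x ^ s * ρ y ^ t ≤ ρ (s • x + t • y)) ∧
    μ = volume.withDensity (fun x => (ρ x : ℝ≥0∞))

/-- The families of symmetric log-concave measures in `𝓟(E_1), …, 𝓟(E_n)`. -/
def logConcaveFamilies {n : ℕ} (d : Fin n → ℕ) : Set (∀ i, Measure (Factor d i)) :=
  {μ | μ ∈ symmetricFamilies d ∧ ∀ i, IsLogConcave (μ i)}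

/-- The entropy inequality with constant `D` holds for all families in the class `𝓒`. -/
def EntropyInequality {n : ℕ} {d : Fin n → ℕ} (c : Fin n → ℝ) (Q : Total d →ₗ[ℝ] Total d)
    (𝓒 : Set (∀ i, Measure (Factor d i))) (D : EReal) : Prop :=
  ∀ μ ∈ 𝓒, entropySum c μ ≤ couplingSup Q μ + D

/-- The functional inequality with constant `D` holds for all even Borel functions
`f_i : E_i → ℝ ∪ {+∞}` with `e^{-f_i} ∈ L¹` and `∑ i, c_i f_i(x_i) ≥ ⟨x, Q x⟩` on `E`. -/
def FunctionalInequality {n : ℕ} {d : Fin n → ℕ} (c : Fin n → ℝ) (Q : Total d →ₗ[ℝ] Total d)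
    (D : EReal) : Prop :=
  ∀ f : ∀ i, Factor d i → EReal,
    (∀ i, Measurable (f i)) →
    (∀ i x, f i x ≠ ⊥) →
    (∀ i x, f i (-x) = f i x) →
    (∀ i, ∫⁻ x, EReal.exp (-f i x) < ∞) →
    (∀ x : Total d, ((inner ℝ x (Q x) : ℝ) : EReal) ≤ ∑ i, (c i : EReal) * f i (x i)) →
    ∏ i, (∫⁻ x, EReal.exp (-f i x)) ^ c i ≤ EReal.exp D

/-- The set of constants `D ∈ ℝ ∪ {+∞}` for which the entropy inequality holds on the class `𝓒`. -/
def admissibleConstants {n : ℕ} {d : Fin n → ℕ} (c : Fin n → ℝ) (Q : Total d →ₗ[ℝ] Total d)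
    (𝓒 : Set (∀ i, Measure (Factor d i))) : Set EReal :=
  {D | D ≠ ⊥ ∧ EntropyInequality c Q 𝓒 D}

/-- The sharp constant `D_s(c, Q)` of the entropy inequality for symmetric measures. -/
def sharpSymmetricConstant {n : ℕ} {d : Fin n → ℕ} (c : Fin n → ℝ)
    (Q : Total d →ₗ[ℝ] Total d) : EReal :=
  sInf (admissibleConstants c Q (symmetricFamilies d))

end EntropicDuality

end

/-!
The proof passes from potentials `f_i` to densities `g_i = e^{-f_i}`, for which the constraint
`∑ i, c_i f_i (x_i) ≥ ⟨x, Q x⟩` reads `∏ i, g_i (x_i) ^ c_i ≤ e^{-⟨x, Q x⟩}` (`Dominated`). Both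
inequalities reduce to densities and measures that live on balls.

*Entropy implies functional inequality.* If `μ_i` has density `g_i / ∫ g_i`, then
`h(μ_i) = log ∫ g_i - ∫ log g_i dμ_i`, and by the constraint `∫ ⟨x, Q x⟩ dγ` is at most
`-∑ i, c_i ∫ log g_i dμ_i` for every coupling `γ`. So the entropy inequality for the `μ_i` gives
`∑ i, c_i log ∫ g_i ≤ D` (`sum_log_le_of_entropySum_le`). The restriction of general `g_i` to balls
is harmless by monotone convergence (`functionalInequality_of_densities`).

*Log-concave measures suffice.* Suppose first that the diagonal blocks of `Q` are nonnegative.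
Replace `g_i` by the largest function on the ball compatible with the constraint, given the other `g_j`
(`conjugate`). It is an infimum of functions `x_i ↦ e^{-⟨x, Q x⟩ / c_i}` times constants, which are
log-concave, as `⟨x, Q x⟩` is convex in `x_i`. Doing this for one index after the other produces
even log-concave majorants that satisfy the same constraint (`exists_logConcave_majorant`), so the
functional inequality follows from the entropy inequality for log-concave measures. If instead some
diagonal block of `Q` takes a negative value at a unit vector `u`, take uniform measures on unit
balls and elongate the one in question by a factor `1 + s` in the direction `u`. The entropies do
not decrease, while the supremum over couplings is `≤ O(1 + s) - ε s ^ 2`. Hence no finite constant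
is admissible, even for log-concave measures (`nonneg_of_entropyInequality`).

*Functional implies entropy inequality.* On products of compact spaces the supremum over couplings
equals the infimum of `∑ i, ∫ φ_i dμ_i` over continuous `φ_i` with `∑ i, φ_i (x_i) ≥ ⟨x, Q x⟩`
(`exists_coupling_integral_eq_kantorovichDual`, by the Hahn-Banach and Riesz-Markov-Kakutani
theorems). For symmetric measures on balls, the potentials can be made even. With `c_i f_i = φ_i` on
the ball and `f_i = ∞` outside, Gibbs' inequality `h(μ_i) ≤ ∫ f_i dμ_i + log ∫ e^{-f_i}`
(`neg_integral_log_rnDeriv_le`) gives the claim (`sum_entropy_le_of_support`). General symmetric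
measures are conditioned on balls of radius `k → ∞`. Their entropies converge, and the suprema over
couplings behave well in the limit because couplings of the conditioned measures extend to couplings
of the original ones at a cost controlled by second moments (`mul_integral_le_of_smul_le`,
`sum_entropy_le`).

So the three inequalities hold with the same constants (`functionalInequality_tfae`). The admissible
constants are exactly the upper bounds of the differences between weighted entropy and supremum over
couplings for log-concave measures, and the sharp constant is the supremum of these differences,
which some sequence approaches.
-/

namespace EntropicDuality

/-! ### Multi-marginal Kantorovich duality on compact spaces -/

section Kantorovich

variable {ι : Type*} [Fintype ι] {K : ι → Type*} [∀ i, TopologicalSpace (K i)]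
  [∀ i, MeasurableSpace (K i)]

/-- The value of the dual Kantorovich problem: the infimum of `∑ i, ∫ φ_i dμ_i` over continuous
potentials with `F x ≤ ∑ i, φ_i (x_i)`. As a function of `F` it is sublinear. -/
noncomputable def kantorovichDual (μ : ∀ i, Measure (K i)) (F : C(∀ i, K i, ℝ)) : ℝ :=
  sInf {s | ∃ φ : ∀ i, C(K i, ℝ), (∀ x, F x ≤ ∑ i, φ i (x i)) ∧ s = ∑ i, ∫ y, φ i y ∂(μ i)}

variable [∀ i, CompactSpace (K i)] [∀ i, BorelSpace (K i)]
  (μ : ∀ i, Measure (K i)) [∀ i, IsProbabilityMeasure (μ i)]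

omit [Fintype ι] in
lemma integrable_continuousMap (i : ι) (φ : C(K i, ℝ)) : Integrable φ (μ i) :=
  φ.continuous.integrable_of_hasCompactSupport (HasCompactSupport.of_compactSpace φ)

lemma exists_le_sum_integral {F : C(∀ i, K i, ℝ)} {φ : ∀ i, C(K i, ℝ)}
    (h : ∀ x, F x ≤ ∑ i, φ i (x i)) : ∃ x, F x ≤ ∑ i, ∫ y, φ i y ∂(μ i) := by
  choose x hx using fun i => exists_le_integral (integrable_continuousMap μ i (φ i))
  exact ⟨x, (h x).trans (Finset.sum_le_sum fun i _ => hx i)⟩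

lemma kantorovichDual_le {F : C(∀ i, K i, ℝ)} {φ : ∀ i, C(K i, ℝ)}
    (h : ∀ x, F x ≤ ∑ i, φ i (x i)) : kantorovichDual μ F ≤ ∑ i, ∫ y, φ i y ∂(μ i) := by
  refine csInf_le ⟨-‖F‖, ?_⟩ ⟨φ, h, rfl⟩
  rintro _ ⟨ψ, hψ, rfl⟩
  obtain ⟨x, hx⟩ := exists_le_sum_integral μ hψ
  exact (neg_le_of_abs_le (F.norm_coe_le_norm x)).trans hx

variable [Nonempty ι]

omit [∀ i, BorelSpace (K i)] [∀ i, IsProbabilityMeasure (μ i)] in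
lemma kantorovichDual_set_nonempty (F : C(∀ i, K i, ℝ)) :
    {s | ∃ φ : ∀ i, C(K i, ℝ), (∀ x, F x ≤ ∑ i, φ i (x i)) ∧
      s = ∑ i, ∫ y, φ i y ∂(μ i)}.Nonempty := by
  refine ⟨_, fun i => ContinuousMap.const _ ‖F‖, fun x => ?_, rfl⟩
  have h1 : ‖F‖ ≤ ∑ i : ι, ‖F‖ := by
    obtain ⟨i⟩ := ‹Nonempty ι›
    exact Finset.single_le_sum (f := fun _ => ‖F‖) (fun _ _ => norm_nonneg F) (Finset.mem_univ i)
  exact ((le_abs_self _).trans (F.norm_coe_le_norm x)).trans (by simpa using h1)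

omit [∀ i, BorelSpace (K i)] [∀ i, IsProbabilityMeasure (μ i)] in
lemma exists_potentials_lt {F : C(∀ i, K i, ℝ)} {a : ℝ} (h : kantorovichDual μ F < a) :
    ∃ φ : ∀ i, C(K i, ℝ), (∀ x, F x ≤ ∑ i, φ i (x i)) ∧ ∑ i, ∫ y, φ i y ∂(μ i) < a := by
  obtain ⟨_, ⟨φ, h1, rfl⟩, h2⟩ := exists_lt_of_csInf_lt (kantorovichDual_set_nonempty μ F) h
  exact ⟨φ, h1, h2⟩

lemma kantorovichDual_add_le (F G : C(∀ i, K i, ℝ)) :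
    kantorovichDual μ (F + G) ≤ kantorovichDual μ F + kantorovichDual μ G := by
  refine le_of_forall_pos_lt_add fun ε hε => ?_
  obtain ⟨φ, h1, h2⟩ := exists_potentials_lt μ
    (lt_add_of_pos_right (kantorovichDual μ F) (half_pos hε))
  obtain ⟨ψ, h3, h4⟩ := exists_potentials_lt μ
    (lt_add_of_pos_right (kantorovichDual μ G) (half_pos hε))
  have h5 := kantorovichDual_le μ (F := F + G) (φ := fun i => φ i + ψ i) fun x => by
    simpa [Finset.sum_add_distrib] using add_le_add (h1 x) (h3 x)
  simp only [ContinuousMap.add_apply] at h5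
  simp_rw [fun i => integral_add (integrable_continuousMap μ i (φ i))
    (integrable_continuousMap μ i (ψ i)), Finset.sum_add_distrib] at h5
  linarith

lemma kantorovichDual_smul_le {t : ℝ} (ht : 0 < t) (F : C(∀ i, K i, ℝ)) :
    kantorovichDual μ (t • F) ≤ t * kantorovichDual μ F := by
  refine le_of_forall_pos_lt_add fun ε hε => ?_
  obtain ⟨φ, h1, h2⟩ := exists_potentials_lt μ
    (lt_add_of_pos_right (kantorovichDual μ F) (div_pos hε ht))
  have h5 := kantorovichDual_le μ (F := t • F) (φ := fun i => t • φ i) fun x => by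
    simpa [Finset.mul_sum] using mul_le_mul_of_nonneg_left (h1 x) ht.le
  simp only [ContinuousMap.smul_apply, smul_eq_mul, integral_const_mul, ← Finset.mul_sum] at h5
  have h6 := mul_lt_mul_of_pos_left h2 ht
  rw [mul_add, mul_div_cancel₀ _ ht.ne'] at h6
  linarith

lemma kantorovichDual_smul {t : ℝ} (ht : 0 < t) (F : C(∀ i, K i, ℝ)) :
    kantorovichDual μ (t • F) = t * kantorovichDual μ F := by
  refine le_antisymm (kantorovichDual_smul_le μ ht F) ?_
  have h := kantorovichDual_smul_le μ (inv_pos.2 ht) (t • F)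
  rw [smul_smul, inv_mul_cancel₀ ht.ne', one_smul] at h
  calc _ ≤ t * (t⁻¹ * kantorovichDual μ (t • F)) := by gcongr
    _ = _ := by rw [← mul_assoc, mul_inv_cancel₀ ht.ne', one_mul]

/-- A linear functional below the dual value that attains it at `F`. By sublinearity of the dual
value this is the Hahn-Banach theorem. -/
lemma exists_linearMap_le_kantorovichDual (F : C(∀ i, K i, ℝ)) :
    ∃ ℓ : C(∀ i, K i, ℝ) →ₗ[ℝ] ℝ, ℓ F = kantorovichDual μ F ∧
      ∀ G, ℓ G ≤ kantorovichDual μ G := by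
  have h0 : kantorovichDual μ (0 : C(∀ i, K i, ℝ)) = 0 := by
    have := kantorovichDual_smul μ (two_pos) (0 : C(∀ i, K i, ℝ))
    rw [smul_zero] at this
    linarith
  have hneg : ∀ G, - kantorovichDual μ G ≤ kantorovichDual μ (-G) := fun G => by
    have := kantorovichDual_add_le μ G (-G)
    rw [add_neg_cancel, h0] at this
    linarith
  have hH : ∀ t : ℝ, t • F = 0 → (RingHom.id ℝ t) • kantorovichDual μ F = 0 := by
    intro t ht
    rcases smul_eq_zero.1 ht with h | h
    · simp [h]
    · simp [h, h0]
  obtain ⟨ℓ, h1, h2⟩ := exists_extension_of_le_sublinear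
    (LinearPMap.mkSpanSingleton' F (kantorovichDual μ F) hH) (kantorovichDual μ)
    (fun t ht G => kantorovichDual_smul μ ht G) (kantorovichDual_add_le μ) (by
      rintro ⟨G, hG⟩
      obtain ⟨t, rfl⟩ := Submodule.mem_span_singleton.1 hG
      rw [LinearPMap.mkSpanSingleton'_apply]
      simp only [RingHom.id_apply, smul_eq_mul]
      rcases lt_trichotomy t 0 with ht | rfl | ht
      · have h3 := hneg ((-t) • F)
        rw [kantorovichDual_smul μ (neg_pos.2 ht), neg_smul, neg_neg] at h3
        linarith
      · simp [h0]
      · rw [kantorovichDual_smul μ ht])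
  refine ⟨ℓ, ?_, h2⟩
  have hF : F ∈ (LinearPMap.mkSpanSingleton' F (kantorovichDual μ F) hH).domain :=
    Submodule.mem_span_singleton_self F
  exact (h1 ⟨F, hF⟩).trans (LinearPMap.mkSpanSingleton'_apply_self _ _ _ hF)

variable [∀ i, T2Space (K i)] [∀ i, SecondCountableTopology (K i)]

/-- **Kantorovich duality**: some coupling of the `μ_i` attains the dual value. The functional of
`exists_linearMap_le_kantorovichDual` is positive, hence a measure, and its marginals are the
`μ_i` because it agrees with `∑ i, ∫ φ_i dμ_i` on separated functions. -/
theorem exists_coupling_integral_eq_kantorovichDual [∀ i, HasOuterApproxClosed (K i)]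
    (F : C(∀ i, K i, ℝ)) :
    ∃ γ : Measure (∀ i, K i), IsProbabilityMeasure γ ∧ (∀ i, γ.map (fun x => x i) = μ i) ∧
      ∫ x, F x ∂γ = kantorovichDual μ F := by
  classical
  obtain ⟨ℓ, hF, hle⟩ := exists_linearMap_le_kantorovichDual μ F
  have hpos : ∀ G : C(∀ i, K i, ℝ), 0 ≤ G → 0 ≤ ℓ G := by
    intro G hG
    have h1 := hle (-G)
    have h2 := kantorovichDual_le μ (F := -G) (φ := fun i => 0) fun x => by
      simpa using hG x
    simp only [map_neg, ContinuousMap.zero_apply, integral_zero, Finset.sum_const_zero] at h1 h2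
    linarith
  have hmarg : ∀ i (φ : C(K i, ℝ)),
      ℓ (φ.comp ⟨fun x => x i, continuous_apply i⟩) = ∫ y, φ y ∂(μ i) := by
    intro i
    have key : ∀ φ : C(K i, ℝ),
        ℓ (φ.comp ⟨fun x => x i, continuous_apply i⟩) ≤ ∫ y, φ y ∂(μ i) := by
      intro φ
      refine (hle _).trans ((kantorovichDual_le μ (φ := Pi.single i φ) fun x => ?_).trans_eq ?_)
      · rw [Finset.sum_eq_single i (by intro j _ hj; simp [Pi.single_eq_of_ne hj]) (by simp)]
        simp
      · rw [Finset.sum_eq_single i (by intro j _ hj; simp [Pi.single_eq_of_ne hj]) (by simp)]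
        simp
    intro φ
    refine le_antisymm (key φ) ?_
    have h1 := key (-φ)
    have h2 : (-φ).comp ⟨fun x : ∀ i, K i => x i, continuous_apply i⟩ =
      -(φ.comp ⟨fun x : ∀ i, K i => x i, continuous_apply i⟩) := rfl
    rw [h2, map_neg] at h1
    simp only [ContinuousMap.neg_apply, integral_neg] at h1
    linarith
  let Λ : CompactlySupportedContinuousMap (∀ i, K i) ℝ →ₚ[ℝ] ℝ :=
    PositiveLinearMap.mk₀
      { toFun := fun f => ℓ f.toContinuousMap
        map_add' := fun f g => map_add ℓ f.toContinuousMap g.toContinuousMap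
        map_smul' := fun t f => map_smul ℓ t f.toContinuousMap }
      (fun f hf => hpos _ hf)
  have hint : ∀ G : C(∀ i, K i, ℝ), ∫ x, G x ∂(RealRMK.rieszMeasure Λ) = ℓ G := fun G =>
    RealRMK.integral_rieszMeasure Λ
      ⟨G, HasCompactSupport.of_compactSpace G⟩
  have hfin : IsFiniteMeasure (RealRMK.rieszMeasure Λ) := by infer_instance
  obtain ⟨i₀⟩ := ‹Nonempty ι›
  have hprob : IsProbabilityMeasure (RealRMK.rieszMeasure Λ) := by
    have h1 := hint 1
    have h2 := hmarg i₀ 1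
    have h3 : (1 : C(K i₀, ℝ)).comp ⟨fun x : ∀ i, K i => x i₀, continuous_apply i₀⟩ = 1 := rfl
    rw [h3] at h2
    rw [h2] at h1
    simp only [ContinuousMap.one_apply, integral_const, smul_eq_mul, mul_one, probReal_univ] at h1
    exact ⟨by simpa [Measure.real, ENNReal.toReal_eq_one_iff] using h1⟩
  refine ⟨RealRMK.rieszMeasure Λ, hprob, fun i => ?_, (hint F).trans hF⟩
  have := Measure.isProbabilityMeasure_map (μ := RealRMK.rieszMeasure Λ)
    (measurable_pi_apply i).aemeasurable
  refine ext_of_forall_integral_eq_of_IsFiniteMeasure fun φ => ?_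
  rw [integral_map (measurable_pi_apply i).aemeasurable
    φ.continuous.measurable.aestronglyMeasurable]
  exact (hint (φ.toContinuousMap.comp ⟨fun x => x i, continuous_apply i⟩)).trans (hmarg i _)

end Kantorovich

/-! ### Couplings and the quadratic cost -/

section Couplings

variable {n : ℕ} {d : Fin n → ℕ}

lemma continuous_proj (i : Fin n) : Continuous fun x : Total d => x i := by fun_prop

lemma measurable_proj (i : Fin n) : Measurable fun x : Total d => x i :=
  (continuous_proj i).measurable

lemma continuous_cost (Q : Total d →ₗ[ℝ] Total d) :
    Continuous fun x : Total d => inner ℝ x (Q x) :=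
  continuous_id.inner Q.continuous_of_finiteDimensional

lemma exists_abs_inner_le (Q : Total d →ₗ[ℝ] Total d) :
    ∃ C : ℝ, 0 ≤ C ∧ ∀ x y : Total d, |inner ℝ x (Q y)| ≤ C * (‖x‖ * ‖y‖) := by
  refine ⟨‖LinearMap.toContinuousLinearMap Q‖, norm_nonneg _, fun x y => ?_⟩
  refine (abs_real_inner_le_norm _ _).trans ?_
  have := (LinearMap.toContinuousLinearMap Q).le_opNorm y
  calc ‖x‖ * ‖Q y‖ ≤ ‖x‖ * (‖LinearMap.toContinuousLinearMap Q‖ * ‖y‖) := by gcongr; exact this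
    _ = _ := by ring

lemma exists_abs_cost_le (Q : Total d →ₗ[ℝ] Total d) :
    ∃ C : ℝ, 0 ≤ C ∧ ∀ x : Total d, |inner ℝ x (Q x)| ≤ C * ∑ i, ‖x i‖ ^ 2 := by
  obtain ⟨C, h0, h⟩ := exists_abs_inner_le Q
  refine ⟨C, h0, fun x => (h x x).trans_eq ?_⟩
  rw [← PiLp.norm_sq_eq_of_L2, sq]

variable {μ : ∀ i, Measure (Factor d i)} {γ : Measure (Total d)}

lemma integral_comp_proj (hγ : γ ∈ couplings μ) (i : Fin n) {f : Factor d i → ℝ}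
    (hf : AEStronglyMeasurable f (μ i)) : ∫ x, f (x i) ∂γ = ∫ y, f y ∂(μ i) := by
  rw [← hγ.2 i] at hf ⊢
  rw [integral_map (measurable_proj i).aemeasurable hf]

lemma integrable_comp_proj (hγ : γ ∈ couplings μ) (i : Fin n) {f : Factor d i → ℝ}
    (hf : Integrable f (μ i)) : Integrable (fun x => f (x i)) γ := by
  rw [← hγ.2 i] at hf
  exact hf.comp_measurable (measurable_proj i)

lemma ae_comp_proj (hγ : γ ∈ couplings μ) (i : Fin n) {p : Factor d i → Prop}
    (hp : ∀ᵐ y ∂(μ i), p y) : ∀ᵐ x ∂γ, p (x i) := by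
  rw [← hγ.2 i] at hp
  exact ae_of_ae_map (measurable_proj i).aemeasurable hp

lemma integrable_cost (Q : Total d →ₗ[ℝ] Total d) (hγ : γ ∈ couplings μ)
    (hμ : ∀ i, Integrable (fun x => ‖x‖ ^ 2) (μ i)) :
    Integrable (fun x => inner ℝ x (Q x)) γ := by
  obtain ⟨C, -, h⟩ := exists_abs_cost_le Q
  refine Integrable.mono' (g := fun x => C * ∑ i, ‖x i‖ ^ 2) ?_
    (continuous_cost Q).aestronglyMeasurable (Eventually.of_forall fun x => h x)
  exact (integrable_finsetSum _ fun i _ => integrable_comp_proj hγ i (hμ i)).const_mul C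

/-- The product measure is a coupling. -/
lemma couplings_nonempty (hμ : ∀ i, IsProbabilityMeasure (μ i)) : (couplings μ).Nonempty := by
  have hm : Measurable (WithLp.toLp 2 : (∀ i, Factor d i) → Total d) := WithLp.measurable_toLp 2 _
  refine ⟨(Measure.pi μ).map (WithLp.toLp 2),
    Measure.isProbabilityMeasure_map hm.aemeasurable, fun i => ?_⟩
  rw [Measure.map_map (measurable_proj i) hm]
  exact (measurePreserving_eval μ i).map_eq

/-- For marginals with second moments the supremum over couplings is a real number, and it is a
least upper bound in `ℝ`. -/
lemma exists_couplingSup_eq_coe (Q : Total d →ₗ[ℝ] Total d)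
    (hp : ∀ i, IsProbabilityMeasure (μ i))
    (hμ : ∀ i, Integrable (fun x => ‖x‖ ^ 2) (μ i)) :
    ∃ r : ℝ, couplingSup Q μ = r ∧ (∀ γ ∈ couplings μ, ∫ x, inner ℝ x (Q x) ∂γ ≤ r) ∧
      ∀ b : ℝ, (∀ γ ∈ couplings μ, ∫ x, inner ℝ x (Q x) ∂γ ≤ b) → r ≤ b := by
  obtain ⟨C, hC, h⟩ := exists_abs_cost_le Q
  have hle : ∀ b : ℝ, (∀ γ ∈ couplings μ, ∫ x, inner ℝ x (Q x) ∂γ ≤ b) →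
      couplingSup Q μ ≤ b := fun b hb => iSup₂_le fun γ hγ => EReal.coe_le_coe_iff.2 (hb γ hγ)
  have hge : ∀ γ ∈ couplings μ, ((∫ x, inner ℝ x (Q x) ∂γ : ℝ) : EReal) ≤ couplingSup Q μ :=
    fun γ hγ => le_iSup₂ (f := fun γ _ => ((∫ x, inner ℝ x (Q x) ∂γ : ℝ) : EReal)) γ hγ
  have hbd : ∀ γ ∈ couplings μ,
      ∫ x, inner ℝ x (Q x) ∂γ ≤ C * ∑ i, ∫ y, ‖y‖ ^ 2 ∂(μ i) := fun γ hγ => by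
    have h1 : ∀ i, Integrable (fun x : Total d => ‖x i‖ ^ 2) γ := fun i =>
      integrable_comp_proj hγ i (hμ i)
    calc ∫ x, inner ℝ x (Q x) ∂γ ≤ ∫ x, C * ∑ i, ‖x i‖ ^ 2 ∂γ :=
          integral_mono (integrable_cost Q hγ hμ)
            ((integrable_finsetSum _ fun i _ => h1 i).const_mul C)
            fun x => (le_abs_self _).trans (h x)
      _ = _ := by
          rw [integral_const_mul, integral_finsetSum _ fun i _ => h1 i]
          simp_rw [fun i => integral_comp_proj hγ i (hμ i).aestronglyMeasurable]
  obtain ⟨γ₀, hγ₀⟩ := couplings_nonempty hp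
  have hbot : couplingSup Q μ ≠ ⊥ := fun hb => by
    have := hge γ₀ hγ₀
    rw [hb, le_bot_iff] at this
    exact EReal.coe_ne_bot _ this
  have htop : couplingSup Q μ ≠ ⊤ := fun hb => by
    have := hle _ hbd
    rw [hb, top_le_iff] at this
    exact EReal.coe_ne_top _ this
  lift couplingSup Q μ to ℝ using ⟨htop, hbot⟩ with r
  exact ⟨r, rfl, fun γ hγ => EReal.coe_le_coe_iff.1 (hge γ hγ),
    fun b hb => EReal.coe_le_coe_iff.1 (hle b hb)⟩

end Couplings

/-! ### Shannon entropy -/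

section Entropy

variable {m : ℕ} {μ : Measure (EuclideanSpace ℝ (Fin m))}

lemma entropy_eq_coe (h : Integrable (fun x => Real.log (μ.rnDeriv volume x).toReal) μ) :
    entropy μ = ((-∫ x, Real.log (μ.rnDeriv volume x).toReal ∂μ : ℝ) : EReal) := by
  have h1 := h.lintegral_lt_top
  have h2 := h.neg.lintegral_lt_top
  have h3 := integral_eq_lintegral_pos_part_sub_lintegral_neg_part h
  simp only [Pi.neg_apply] at h2
  rw [entropy, h3, neg_sub, EReal.coe_sub, EReal.coe_ennreal_toReal h1.ne,
    EReal.coe_ennreal_toReal h2.ne]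

lemma lintegral_mul_inv_rnDeriv_le [SigmaFinite μ] (hμ : μ ≪ volume)
    {G : EuclideanSpace ℝ (Fin m) → ℝ≥0∞} (hG : Measurable G) :
    ∫⁻ x, G x * (μ.rnDeriv volume x)⁻¹ ∂μ ≤ ∫⁻ x, G x := by
  rw [← lintegral_rnDeriv_mul hμ (by fun_prop)]
  refine lintegral_mono fun x => ?_
  calc μ.rnDeriv volume x * (G x * (μ.rnDeriv volume x)⁻¹)
      = G x * (μ.rnDeriv volume x * (μ.rnDeriv volume x)⁻¹) := by ring
    _ ≤ G x * 1 := by gcongr; exact ENNReal.mul_inv_le_one _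
    _ = G x := mul_one _

/-- The positive part of `-log ρ` is integrable, by comparison of `ρ` with `exp (-‖x‖ ^ 2)`. -/
lemma MemP.lintegral_neg_log_lt_top (h : MemP μ) :
    ∫⁻ x, ENNReal.ofReal (-Real.log (μ.rnDeriv volume x).toReal) ∂μ < ∞ := by
  have := h.isProbabilityMeasure
  have hgauss : Integrable (fun x : EuclideanSpace ℝ (Fin m) => Real.exp (-‖x‖ ^ 2)) := by
    have := (GaussianFourier.integrable_cexp_neg_mul_sq_norm_add (V := EuclideanSpace ℝ (Fin m))
      (b := 1) (by simp) 0 0).norm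
    simpa [Complex.norm_exp, ← Complex.ofReal_pow] using this
  have hle : ∀ᵐ x ∂μ, ENNReal.ofReal (-Real.log (μ.rnDeriv volume x).toReal) ≤
      ENNReal.ofReal (‖x‖ ^ 2) +
        ENNReal.ofReal (Real.exp (-‖x‖ ^ 2)) * (μ.rnDeriv volume x)⁻¹ := by
    filter_upwards [h.absolutelyContinuous (Measure.rnDeriv_lt_top μ volume)] with x hx
    rcases eq_or_ne (μ.rnDeriv volume x) 0 with h0 | h0
    · simp [h0]
    have hpos : 0 < (μ.rnDeriv volume x).toReal := ENNReal.toReal_pos h0 hx.ne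
    have hinv : (μ.rnDeriv volume x)⁻¹ = ENNReal.ofReal ((μ.rnDeriv volume x).toReal⁻¹) := by
      rw [ENNReal.ofReal_inv_of_pos hpos, ENNReal.ofReal_toReal hx.ne]
    rw [hinv, ← ENNReal.ofReal_mul (Real.exp_pos _).le, ← ENNReal.ofReal_add (by positivity)
      (by positivity)]
    refine ENNReal.ofReal_le_ofReal ?_
    have h1 := Real.log_le_sub_one_of_pos
      (mul_pos (Real.exp_pos (-‖x‖ ^ 2)) (inv_pos.2 hpos))
    rw [Real.log_mul (Real.exp_pos _).ne' (inv_pos.2 hpos).ne', Real.log_exp, Real.log_inv] at h1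
    linarith
  refine (lintegral_mono_ae hle).trans_lt ?_
  rw [lintegral_add_left (by fun_prop)]
  refine ENNReal.add_lt_top.2 ⟨h.secondMoment.lintegral_lt_top, ?_⟩
  exact (lintegral_mul_inv_rnDeriv_le h.absolutelyContinuous (by fun_prop)).trans_lt
    hgauss.lintegral_lt_top

lemma MemP.integrable_log_of_entropy_ne_bot (h : MemP μ) (hb : entropy μ ≠ ⊥) :
    Integrable (fun x => Real.log (μ.rnDeriv volume x).toReal) μ := by
  have hm : Measurable fun x => Real.log (μ.rnDeriv volume x).toReal := by fun_prop
  refine ⟨hm.aestronglyMeasurable, ?_⟩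
  have h1 := h.lintegral_neg_log_lt_top
  have h2 : ∫⁻ x, ENNReal.ofReal (Real.log (μ.rnDeriv volume x).toReal) ∂μ < ∞ := by
    by_contra hcon
    rw [not_lt, top_le_iff] at hcon
    exact hb (by rw [entropy, hcon, EReal.coe_ennreal_top, EReal.sub_top])
  rw [hasFiniteIntegral_iff_norm]
  refine lt_of_le_of_lt (lintegral_mono fun x => ?_)
    ((lintegral_add_left (by fun_prop) _).trans_lt (ENNReal.add_lt_top.2 ⟨h1, h2⟩))
  rw [Real.norm_eq_abs]
  rcases le_total 0 (Real.log (μ.rnDeriv volume x).toReal) with h | h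
  · rw [abs_of_nonneg h]; exact le_add_self
  · rw [abs_of_nonpos h]; exact le_self_add

lemma rnDeriv_toReal_pos [SigmaFinite μ] (hμ : μ ≪ volume) :
    ∀ᵐ x ∂μ, 0 < (μ.rnDeriv volume x).toReal := by
  filter_upwards [hμ (Measure.rnDeriv_lt_top μ volume), Measure.rnDeriv_pos hμ] with x h1 h2
  exact ENNReal.toReal_pos h2.ne' h1.ne

/-- **Gibbs' inequality**: `h(μ) ≤ ∫ f dμ + log ∫ e^{-f}`, written for `g = e^{-f}`. -/
lemma neg_integral_log_rnDeriv_le [IsProbabilityMeasure μ] (hμ : μ ≪ volume)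
    (hlog : Integrable (fun x => Real.log (μ.rnDeriv volume x).toReal) μ)
    {g : EuclideanSpace ℝ (Fin m) → ℝ≥0} (hg : Measurable g) (hpos : ∀ᵐ x ∂μ, 0 < g x)
    (hglog : Integrable (fun x => Real.log (g x)) μ)
    (hZ0 : ∫⁻ x, g x ≠ 0) (hZ : ∫⁻ x, g x ≠ ∞) :
    -∫ x, Real.log (μ.rnDeriv volume x).toReal ∂μ ≤
      -∫ x, Real.log (g x) ∂μ + Real.log (∫⁻ x, g x).toReal := by
  set Z : ℝ := (∫⁻ x, g x).toReal with hZdef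
  have hZpos : 0 < Z := ENNReal.toReal_pos hZ0 hZ
  set r : EuclideanSpace ℝ (Fin m) → ℝ := fun x => g x * (μ.rnDeriv volume x).toReal⁻¹ with hr
  have hrm : Measurable r := by fun_prop
  have hr0 : ∀ x, 0 ≤ r x := fun x => by positivity
  have hlint : ∫⁻ x, ENNReal.ofReal (r x) ∂μ ≤ ∫⁻ x, g x := by
    refine le_trans (lintegral_mono_ae ?_) (lintegral_mul_inv_rnDeriv_le hμ hg.coe_nnreal_ennreal)
    filter_upwards [rnDeriv_toReal_pos hμ] with x hx
    rw [hr, ENNReal.ofReal_mul (by positivity), ENNReal.ofReal_inv_of_pos hx,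
      ENNReal.ofReal_toReal (by rintro h; simp [h] at hx), ENNReal.ofReal_coe_nnreal]
  have hrint : Integrable r μ := by
    refine ⟨hrm.aestronglyMeasurable, ?_⟩
    rw [hasFiniteIntegral_iff_ofReal (Eventually.of_forall hr0)]
    exact hlint.trans_lt hZ.lt_top
  have hrle : ∫ x, r x ∂μ ≤ Z := by
    rw [integral_eq_lintegral_of_nonneg_ae (Eventually.of_forall hr0) hrm.aestronglyMeasurable]
    exact ENNReal.toReal_mono hZ hlint
  have hmain : ∫ x, (Real.log (g x) - Real.log (μ.rnDeriv volume x).toReal) ∂μ ≤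
      ∫ x, (r x * Z⁻¹ - 1 + Real.log Z) ∂μ := by
    refine integral_mono_ae (hglog.sub hlog) (by fun_prop) ?_
    filter_upwards [hpos, rnDeriv_toReal_pos hμ] with x h1 h2
    have h1' : (0 : ℝ) < g x := h1
    have h3 := Real.log_le_sub_one_of_pos (mul_pos (mul_pos h1' (inv_pos.2 h2)) (inv_pos.2 hZpos))
    rw [Real.log_mul (by positivity) (by positivity), Real.log_mul (by positivity)
      (by positivity), Real.log_inv, Real.log_inv] at h3
    simp only [hr]
    linarith
  rw [integral_sub hglog hlog, integral_add (by fun_prop) (by fun_prop),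
    integral_sub (by fun_prop) (by fun_prop), integral_mul_const] at hmain
  simp only [integral_const, probReal_univ, smul_eq_mul, one_mul] at hmain
  have : (∫ x, r x ∂μ) * Z⁻¹ ≤ 1 := by
    rw [← div_eq_mul_inv, div_le_one hZpos]; exact hrle
  linarith

end Entropy

/-! ### Probability measures with a given unnormalized density -/

section Normalized

variable {m : ℕ}

/-- The probability measure with density proportional to `g`. It is meaningful if
`0 < ∫ g < ∞`. -/
noncomputable def normalized (g : EuclideanSpace ℝ (Fin m) → ℝ≥0) :
    Measure (EuclideanSpace ℝ (Fin m)) :=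
  volume.withDensity fun x => ((g x / (∫⁻ y, g y).toNNReal : ℝ≥0) : ℝ≥0∞)

/-- The unnormalized densities that occur below: even, bounded Borel functions that vanish outside
a ball and have positive integral. -/
structure IsDensity (g : EuclideanSpace ℝ (Fin m) → ℝ≥0) : Prop where
  measurable : Measurable g
  even : ∀ x, g (-x) = g x
  bounded : ∃ M : ℝ≥0, ∀ x, g x ≤ M
  support : ∃ R : ℝ, ∀ x, R < ‖x‖ → g x = 0
  lintegral_ne_zero : ∫⁻ x, g x ≠ 0

namespace IsDensity

variable {g : EuclideanSpace ℝ (Fin m) → ℝ≥0}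

lemma lintegral_ne_top (hg : IsDensity g) : ∫⁻ x, g x ≠ ∞ := by
  obtain ⟨M, hM⟩ := hg.bounded
  obtain ⟨R, hR⟩ := hg.support
  have h1 : ∫⁻ x, (g x : ℝ≥0∞) ≤ ∫⁻ x : EuclideanSpace ℝ (Fin m),
      (Metric.closedBall 0 R).indicator (fun _ => (M : ℝ≥0∞)) x := by
    refine lintegral_mono fun x => ?_
    by_cases hx : x ∈ Metric.closedBall (0 : EuclideanSpace ℝ (Fin m)) R
    · rw [Set.indicator_of_mem hx]; exact ENNReal.coe_le_coe.2 (hM x)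
    · rw [Set.indicator_of_notMem hx, hR x (by simpa using hx)]; simp
  refine (h1.trans_lt ?_).ne
  rw [lintegral_indicator Metric.isClosed_closedBall.measurableSet, setLIntegral_const]
  exact ENNReal.mul_lt_top ENNReal.coe_lt_top measure_closedBall_lt_top

lemma integral_pos (hg : IsDensity g) : 0 < (∫⁻ x, g x).toReal :=
  ENNReal.toReal_pos hg.lintegral_ne_zero hg.lintegral_ne_top

lemma measurable_div (hg : IsDensity g) :
    Measurable fun x => g x / (∫⁻ y, g y).toNNReal := hg.measurable.div_const _

lemma isProbabilityMeasure (hg : IsDensity g) : IsProbabilityMeasure (normalized g) := by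
  refine ⟨?_⟩
  rw [normalized, withDensity_apply _ MeasurableSet.univ, setLIntegral_univ]
  have h0 : (∫⁻ y, g y).toNNReal ≠ 0 := by
    rw [ENNReal.toNNReal_ne_zero]; exact ⟨hg.lintegral_ne_zero, hg.lintegral_ne_top⟩
  simp_rw [ENNReal.coe_div h0, ENNReal.coe_toNNReal hg.lintegral_ne_top, div_eq_mul_inv]
  rw [lintegral_mul_const _ hg.measurable.coe_nnreal_ennreal,
    ENNReal.mul_inv_cancel hg.lintegral_ne_zero hg.lintegral_ne_top]

lemma integrable_of_bdd (hg : IsDensity g) {f : EuclideanSpace ℝ (Fin m) → ℝ}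
    (hf : Measurable f) {B : ℝ} (hB : ∀ x, |g x * f x| ≤ B) : Integrable f (normalized g) := by
  rw [normalized, integrable_withDensity_iff_integrable_smul hg.measurable_div]
  obtain ⟨R, hR⟩ := hg.support
  set Z := (∫⁻ y, g y).toNNReal
  have h1 : Integrable ((Metric.closedBall (0 : EuclideanSpace ℝ (Fin m)) R).indicator
      fun _ => B / Z) :=
    (integrable_indicator_iff Metric.isClosed_closedBall.measurableSet).2
      (integrableOn_const measure_closedBall_lt_top.ne)
  refine h1.mono' (by
    have := hg.measurable
    have h2 : Measurable fun x => ((g x / Z : ℝ≥0) : ℝ) * f x := by fun_prop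
    exact h2.aestronglyMeasurable) (Eventually.of_forall fun x => ?_)
  by_cases hx : x ∈ Metric.closedBall (0 : EuclideanSpace ℝ (Fin m)) R
  · rw [Set.indicator_of_mem hx, NNReal.smul_def, smul_eq_mul, NNReal.coe_div, div_mul_eq_mul_div,
      Real.norm_eq_abs, abs_div, NNReal.abs_eq]
    gcongr
    exact hB x
  · rw [Set.indicator_of_notMem hx, hR x (by simpa using hx)]; simp

lemma integrable_norm_sq (hg : IsDensity g) : Integrable (fun x => ‖x‖ ^ 2) (normalized g) := by
  obtain ⟨M, hM⟩ := hg.bounded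
  obtain ⟨R, hR⟩ := hg.support
  refine hg.integrable_of_bdd (by fun_prop) (B := M * R ^ 2) fun x => ?_
  rcases lt_or_ge R ‖x‖ with h | h
  · rw [hR x h]; simp; positivity
  · rw [abs_of_nonneg (by positivity)]
    gcongr
    exact hM x

lemma integrable_log (hg : IsDensity g) : Integrable (fun x => Real.log (g x)) (normalized g) := by
  obtain ⟨M, hM⟩ := hg.bounded
  obtain ⟨B, hB⟩ := (isCompact_Icc (a := (0 : ℝ)) (b := M)).exists_bound_of_continuousOn
    Real.continuous_mul_log.continuousOn
  have := hg.measurable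
  exact hg.integrable_of_bdd (by fun_prop) fun x => hB (g x) ⟨(g x).2, hM x⟩

lemma absolutelyContinuous : normalized g ≪ volume := withDensity_absolutelyContinuous _ _

lemma memP (hg : IsDensity g) : MemP (normalized g) :=
  ⟨hg.isProbabilityMeasure, absolutelyContinuous, hg.integrable_norm_sq⟩

lemma isNegInvariant (hg : IsDensity g) : (normalized g).IsNegInvariant := by
  refine ⟨Measure.ext fun s hs => ?_⟩
  rw [Measure.neg, Measure.map_apply measurable_neg hs, normalized,
    withDensity_apply _ (measurable_neg hs), withDensity_apply _ hs,
    ← (Measure.measurePreserving_neg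
      (volume : Measure (EuclideanSpace ℝ (Fin m)))).setLIntegral_comp_preimage hs
      hg.measurable_div.coe_nnreal_ennreal]
  simp_rw [hg.even]

lemma ae_pos (hg : IsDensity g) : ∀ᵐ x ∂(normalized g), 0 < g x := by
  rw [normalized, ae_withDensity_iff hg.measurable_div.coe_nnreal_ennreal]
  refine Eventually.of_forall fun x hx => pos_iff_ne_zero.2 fun h0 => hx (by simp [h0])

lemma log_rnDeriv_ae (hg : IsDensity g) : ∀ᵐ x ∂(normalized g),
    Real.log ((normalized g).rnDeriv volume x).toReal =
      Real.log (g x) - Real.log (∫⁻ y, g y).toReal := by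
  have h1 : (normalized g).rnDeriv volume =ᵐ[volume] _ :=
    Measure.rnDeriv_withDensity volume hg.measurable_div.coe_nnreal_ennreal
  filter_upwards [absolutelyContinuous (g := g) h1, hg.ae_pos] with x h2 h3
  have h3' : (g x : ℝ) ≠ 0 := by simpa using h3.ne'
  rw [h2, ENNReal.coe_toReal, NNReal.coe_div, Real.log_div h3' (by
    simpa [ENNReal.coe_toNNReal_eq_toReal] using hg.integral_pos.ne')]
  rfl

lemma integrable_log_rnDeriv (hg : IsDensity g) :
    Integrable (fun x => Real.log ((normalized g).rnDeriv volume x).toReal) (normalized g) := by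
  have := hg.isProbabilityMeasure
  exact (hg.integrable_log.sub (integrable_const _)).congr
    (hg.log_rnDeriv_ae.mono fun x hx => hx.symm)

lemma entropy_eq (hg : IsDensity g) : entropy (normalized g) =
    ((Real.log (∫⁻ y, g y).toReal - ∫ x, Real.log (g x) ∂(normalized g) : ℝ) : EReal) := by
  have := hg.isProbabilityMeasure
  rw [entropy_eq_coe hg.integrable_log_rnDeriv, integral_congr_ae hg.log_rnDeriv_ae,
    integral_sub hg.integrable_log (integrable_const _)]
  simp

lemma isLogConcave (hg : IsDensity g)
    (h : ∀ x y, ∀ s t : ℝ, 0 < s → 0 < t → s + t = 1 → g x ^ s * g y ^ t ≤ g (s • x + t • y)) :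
    IsLogConcave (normalized g) := by
  refine ⟨_, hg.measurable_div, fun x y s t hs ht hst => ?_, rfl⟩
  rw [NNReal.div_rpow, NNReal.div_rpow, div_mul_div_comm, ← NNReal.rpow_add_of_nonneg _ hs.le ht.le,
    hst, NNReal.rpow_one]
  gcongr
  exact h x y s t hs ht hst

end IsDensity

end Normalized

/-! ### The functional inequality in terms of densities -/

section Density

variable {n : ℕ} {d : Fin n → ℕ} {c : Fin n → ℝ} {Q : Total d →ₗ[ℝ] Total d}

/-- The constraint `∑ i, c_i f_i (x_i) ≥ ⟨x, Q x⟩` for `g_i = e^{-f_i}`. -/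
def Dominated (c : Fin n → ℝ) (Q : Total d →ₗ[ℝ] Total d) (g : ∀ i, Factor d i → ℝ≥0) : Prop :=
  ∀ x : Total d, ∏ i, g i (x i) ^ c i ≤ Real.toNNReal (Real.exp (-inner ℝ x (Q x)))

lemma Dominated.mono (hc : ∀ i, 0 < c i) {g g' : ∀ i, Factor d i → ℝ≥0}
    (h : Dominated c Q g') (hle : ∀ i x, g i x ≤ g' i x) : Dominated c Q g := fun x =>
  (Finset.prod_le_prod' fun i _ => NNReal.rpow_le_rpow (hle i _) (hc i).le).trans (h x)

lemma Dominated.cost_le {g : ∀ i, Factor d i → ℝ≥0} (h : Dominated c Q g) {x : Total d}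
    (hx : ∀ i, 0 < g i (x i)) :
    inner ℝ x (Q x) ≤ -∑ i, c i * Real.log (g i (x i)) := by
  have h1 := NNReal.coe_le_coe.2 (h x)
  rw [Real.coe_toNNReal _ (Real.exp_pos _).le, NNReal.coe_prod] at h1
  have h2 : ∏ i, ((g i (x i) ^ c i : ℝ≥0) : ℝ) = Real.exp (∑ i, c i * Real.log (g i (x i))) := by
    rw [Real.exp_sum]
    refine Finset.prod_congr rfl fun i _ => ?_
    rw [NNReal.coe_rpow, Real.rpow_def_of_pos (by exact_mod_cast hx i), mul_comm]
  rw [h2, Real.exp_le_exp] at h1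
  linarith

lemma prod_rpow_eq_ofReal_exp {Z : Fin n → ℝ≥0∞} (h0 : ∀ i, Z i ≠ 0) (h1 : ∀ i, Z i ≠ ∞) :
    ∏ i, Z i ^ c i = ENNReal.ofReal (Real.exp (∑ i, c i * Real.log (Z i).toReal)) := by
  rw [Real.exp_sum, ENNReal.ofReal_prod_of_nonneg fun i _ => (Real.exp_pos _).le]
  refine Finset.prod_congr rfl fun i _ => ?_
  have hpos : 0 < (Z i).toReal := ENNReal.toReal_pos (h0 i) (h1 i)
  rw [mul_comm, ← Real.rpow_def_of_pos hpos, ← ENNReal.ofReal_rpow_of_pos hpos,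
    ENNReal.ofReal_toReal (h1 i)]

lemma coe_sum_ereal {ι : Type*} (s : Finset ι) (a : ι → ℝ) :
    ((∑ i ∈ s, a i : ℝ) : EReal) = ∑ i ∈ s, (a i : EReal) :=
  map_sum (⟨⟨Real.toEReal, EReal.coe_zero⟩, EReal.coe_add⟩ : ℝ →+ EReal) a s

lemma entropySum_eq_coe {μ : ∀ i, Measure (Factor d i)} {e : Fin n → ℝ}
    (h : ∀ i, entropy (μ i) = (e i : EReal)) :
    entropySum c μ = ((∑ i, c i * e i : ℝ) : EReal) := by
  rw [entropySum, coe_sum_ereal]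
  exact Finset.sum_congr rfl fun i _ => by rw [h, EReal.coe_mul]

/-- Testing the entropy inequality on the measures with densities proportional to `g_i` gives the
functional inequality for `g`: on the support of a coupling, the cost is at most
`-∑ i, c_i log g_i`. -/
lemma sum_log_le_of_entropySum_le {g : ∀ i, Factor d i → ℝ≥0} (hg : ∀ i, IsDensity (g i))
    (hdom : Dominated c Q g) {D : ℝ}
    (h : entropySum c (fun i => normalized (g i)) ≤
      couplingSup Q (fun i => normalized (g i)) + D) :
    ∑ i, c i * Real.log (∫⁻ y, g i y).toReal ≤ D := by
  obtain ⟨r, hr, -, hle⟩ := exists_couplingSup_eq_coe Q (fun i => (hg i).isProbabilityMeasure)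
    (fun i => (hg i).integrable_norm_sq)
  rw [entropySum_eq_coe fun i => (hg i).entropy_eq, hr, ← EReal.coe_add, EReal.coe_le_coe_iff] at h
  have h1 : r ≤ -∑ i, c i * ∫ y, Real.log (g i y) ∂(normalized (g i)) := by
    refine hle _ fun γ hγ => ?_
    have hi : ∀ i, Integrable (fun x : Total d => c i * Real.log (g i (x i))) γ := fun i =>
      (integrable_comp_proj hγ i (hg i).integrable_log).const_mul _
    have h2 : ∫ x, inner ℝ x (Q x) ∂γ ≤ ∫ x, -∑ i, c i * Real.log (g i (x i)) ∂γ := by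
      refine integral_mono_ae (integrable_cost Q hγ fun i => (hg i).integrable_norm_sq)
        (integrable_finsetSum _ fun i _ => hi i).neg ?_
      filter_upwards [ae_all_iff.2 fun i => ae_comp_proj hγ i (hg i).ae_pos] with x hx
      exact hdom.cost_le hx
    rw [integral_neg, integral_finsetSum _ fun i _ => hi i] at h2
    simp_rw [integral_const_mul, fun i => integral_comp_proj hγ i
      (hg i).integrable_log.aestronglyMeasurable] at h2
    exact h2
  simp_rw [mul_sub, Finset.sum_sub_distrib] at h
  linarith

/-- For `y` with `g_j (y_j) > 0`, the upper bound for `g_i (x)` that the constraint imposes at the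
point obtained from `y` by replacing its `i`-th component by `x`. -/
noncomputable def weight (c : Fin n → ℝ) (Q : Total d →ₗ[ℝ] Total d) (g : ∀ i, Factor d i → ℝ≥0)
    (y : ∀ j, Factor d j) (i : Fin n) (x : Factor d i) : ℝ≥0 :=
  (Real.toNNReal (Real.exp (-inner ℝ (WithLp.toLp 2 (Function.update y i x) : Total d)
    (Q (WithLp.toLp 2 (Function.update y i x))))) /
      ∏ j ∈ Finset.univ.erase i, g j (y j) ^ c j) ^ (c i)⁻¹

lemma continuous_weight (hc : ∀ i, 0 < c i) (g : ∀ i, Factor d i → ℝ≥0) (y : ∀ j, Factor d j)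
    (i : Fin n) : Continuous (weight c Q g y i) := by
  have h1 : Continuous fun x => (WithLp.toLp 2 (Function.update y i x) : Total d) :=
    (PiLp.continuous_toLp 2 _).comp (continuous_const.update i continuous_id)
  refine (NNReal.continuous_rpow_const (inv_pos.2 (hc i)).le).comp ?_
  exact (continuous_real_toNNReal.comp
    (Real.continuous_exp.comp ((continuous_cost Q).comp h1).neg)).div_const _

lemma Dominated.le_weight (hc : ∀ i, 0 < c i) {g : ∀ i, Factor d i → ℝ≥0} (h : Dominated c Q g)
    {y : ∀ j, Factor d j} (hy : ∀ j, 0 < g j (y j)) (i : Fin n) (x : Factor d i) :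
    g i x ≤ weight c Q g y i x := by
  have hpos : 0 < ∏ j ∈ Finset.univ.erase i, g j (y j) ^ c j :=
    Finset.prod_pos fun j _ => NNReal.rpow_pos (hy j)
  rw [weight, NNReal.le_rpow_inv_iff (hc i), le_div_iff₀ hpos]
  refine le_of_eq_of_le ?_ (h (WithLp.toLp 2 (Function.update y i x)))
  rw [← Finset.mul_prod_erase _ _ (Finset.mem_univ i)]
  congr 1
  · simp
  · exact Finset.prod_congr rfl fun j hj => by
      simp [Function.update_of_ne (Finset.ne_of_mem_erase hj)]

lemma exists_weight_le (hc : ∀ i, 0 < c i) (g : ∀ i, Factor d i → ℝ≥0) (y : ∀ j, Factor d j)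
    (i : Fin n) (R : ℝ) : ∃ M : ℝ≥0, ∀ x, ‖x‖ ≤ R → weight c Q g y i x ≤ M := by
  obtain ⟨M, hM⟩ := (isCompact_closedBall (0 : Factor d i) R).bddAbove_image
    (continuous_weight (Q := Q) hc g y i).continuousOn
  exact ⟨M, fun x hx => hM ⟨x, by simpa using hx, rfl⟩⟩

lemma exists_pos_of_lintegral_ne_zero {m : ℕ} {g : EuclideanSpace ℝ (Fin m) → ℝ≥0}
    (h : ∫⁻ x, g x ≠ 0) : ∃ x, 0 < g x := by
  by_contra! hcon
  have h0 : ∀ x, g x = 0 := fun x => le_antisymm (hcon x) bot_le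
  exact h (by simp [h0])

/-- The functional inequality follows from its special case of bounded densities with bounded
support: restrict `e^{-f_i}` to balls. Boundedness is automatic, by the constraint. -/
lemma functionalInequality_of_densities (hc : ∀ i, 0 < c i) {D : ℝ}
    (H : ∀ g : ∀ i, Factor d i → ℝ≥0, (∀ i, IsDensity (g i)) → Dominated c Q g →
      ∑ i, c i * Real.log (∫⁻ y, g i y).toReal ≤ D) :
    FunctionalInequality c Q D := by
  intro f hfm hfb hfe hfi hf
  set g : ∀ i, Factor d i → ℝ≥0 := fun i x => (EReal.exp (-f i x)).toNNReal with hgdef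
  have hgc : ∀ i x, (g i x : ℝ≥0∞) = EReal.exp (-f i x) := fun i x =>
    ENNReal.coe_toNNReal fun h =>
      hfb i x (by rwa [EReal.exp_eq_top_iff, EReal.neg_eq_top_iff] at h)
  have hgm : ∀ i, Measurable (g i) := fun i => (hfm i).neg.ereal_exp.ennreal_toNNReal
  have hdom : Dominated c Q g := by
    intro x
    by_cases hx : ∃ i, f i (x i) = ⊤
    · obtain ⟨i, hi⟩ := hx
      rw [Finset.prod_eq_zero (Finset.mem_univ i)]
      · exact bot_le
      · simp [hgdef, hi, (hc i).ne']
    · push Not at hx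
      obtain ⟨r, hr⟩ : ∃ r : Fin n → ℝ, ∀ i, f i (x i) = (r i : EReal) :=
        ⟨_, fun i => (EReal.coe_toReal (hx i) (hfb i _)).symm⟩
      have h1 := hf x
      simp_rw [hr, ← EReal.coe_mul] at h1
      rw [← coe_sum_ereal, EReal.coe_le_coe_iff] at h1
      have h2 : ∀ i, g i (x i) = Real.toNNReal (Real.exp (-r i)) := fun i => by
        simp only [hgdef]
        rw [hr i, ← EReal.coe_neg, EReal.exp_coe]
        rfl
      have h3 : ∏ i, g i (x i) ^ c i = Real.toNNReal (Real.exp (-∑ i, c i * r i)) := by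
        rw [← Finset.sum_neg_distrib, Real.exp_sum,
          Real.toNNReal_prod_of_nonneg fun i _ => (Real.exp_pos _).le]
        refine Finset.prod_congr rfl fun i _ => ?_
        rw [h2, ← Real.toNNReal_rpow_of_nonneg (Real.exp_pos _).le, ← Real.exp_mul]
        congr 2; ring
      rw [h3]
      gcongr
  simp_rw [← hgc]
  simp_rw [← hgc] at hfi
  by_cases hZ : ∃ i, ∫⁻ x, (g i x : ℝ≥0∞) = 0
  · obtain ⟨i, hi⟩ := hZ
    rw [Finset.prod_eq_zero (Finset.mem_univ i) (by rw [hi, ENNReal.zero_rpow_of_pos (hc i)])]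
    exact bot_le
  push Not at hZ
  choose y hy using fun i => exists_pos_of_lintegral_ne_zero (hZ i)
  set G : ℕ → ∀ i, Factor d i → ℝ≥0 := fun k i =>
    (Metric.closedBall (0 : Factor d i) k).indicator (g i) with hG
  have hGle : ∀ k i x, G k i x ≤ g i x := fun k i x => Set.indicator_le_self' (by simp) x
  have hlim : ∀ i, Tendsto (fun k => ∫⁻ x, (G k i x : ℝ≥0∞)) atTop (𝓝 (∫⁻ x, (g i x : ℝ≥0∞))) := by
    intro i
    have h1 := tendsto_measure_iUnion_atTop
      (μ := (volume : Measure (Factor d i)).withDensity fun x => (g i x : ℝ≥0∞))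
      (s := fun k : ℕ => Metric.closedBall (0 : Factor d i) k)
      (fun k l hkl => Metric.closedBall_subset_closedBall (by exact_mod_cast hkl))
    rw [Metric.iUnion_closedBall_nat, withDensity_apply _ MeasurableSet.univ,
      setLIntegral_univ] at h1
    refine h1.congr fun k => ?_
    simp only [Function.comp_apply]
    rw [withDensity_apply _ Metric.isClosed_closedBall.measurableSet,
      ← lintegral_indicator Metric.isClosed_closedBall.measurableSet]
    refine lintegral_congr fun x => ?_
    simp only [hG]
    by_cases hx : x ∈ Metric.closedBall (0 : Factor d i) k <;> simp [hx]
  have hlim' : Tendsto (fun k => ∏ i, (∫⁻ x, (G k i x : ℝ≥0∞)) ^ c i) atTop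
      (𝓝 (∏ i, (∫⁻ x, (g i x : ℝ≥0∞)) ^ c i)) :=
    ENNReal.tendsto_finsetProd_of_ne_top _
      (fun i _ => ((ENNReal.continuous_rpow_const (y := c i)).tendsto _).comp (hlim i))
      (fun i _ => ENNReal.rpow_ne_top_of_nonneg (hc i).le (hfi i).ne)
  refine le_of_tendsto hlim' ?_
  have hev : ∀ᶠ k in atTop, ∀ i, ∫⁻ x, (G k i x : ℝ≥0∞) ≠ 0 :=
    eventually_all.2 fun i => (hlim i).eventually_ne (hZ i)
  filter_upwards [hev] with k hk
  have hGd : ∀ i, IsDensity (G k i) := fun i =>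
    { measurable := (hgm i).indicator Metric.isClosed_closedBall.measurableSet
      even := fun x => by
        simp only [hG, hgdef]
        by_cases hx : x ∈ Metric.closedBall (0 : Factor d i) k
        · rw [Set.indicator_of_mem hx, Set.indicator_of_mem (by simpa using hx), hfe]
        · rw [Set.indicator_of_notMem hx, Set.indicator_of_notMem (by simpa using hx)]
      bounded := by
        obtain ⟨M, hM⟩ := exists_weight_le (Q := Q) hc g y i k
        refine ⟨M, fun x => ?_⟩
        by_cases hx : x ∈ Metric.closedBall (0 : Factor d i) k
        · exact (hGle k i x).trans ((hdom.le_weight hc hy i x).trans (hM x (by simpa using hx)))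
        · simp [hG, hx]
      support := ⟨k, fun x hx => Set.indicator_of_notMem (by simpa using hx) _⟩
      lintegral_ne_zero := hk i }
  rw [prod_rpow_eq_ofReal_exp hk fun i => (hGd i).lintegral_ne_top, EReal.exp_coe]
  exact ENNReal.ofReal_le_ofReal (Real.exp_le_exp.2 (H _ hGd (hdom.mono hc (hGle k))))

end Density

/-! ### Log-concave majorants -/

section Conjugate

variable {n : ℕ} {d : Fin n → ℕ} {c : Fin n → ℝ} {Q : Total d →ₗ[ℝ] Total d}

/-- The largest `i`-th density supported on the ball of radius `R` that is compatible with the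
constraint when the other densities `g_j` are kept. The infimum runs over all `y` with
`g_j (y_j) > 0` for all `j`, although `y_i` does not matter; it is meaningful if no `g_j` vanishes
identically (the infimum over the empty set is `0`). -/
noncomputable def conjugate (c : Fin n → ℝ) (Q : Total d →ₗ[ℝ] Total d)
    (g : ∀ i, Factor d i → ℝ≥0) (R : ℝ) (i : Fin n) : Factor d i → ℝ≥0 :=
  (Metric.closedBall (0 : Factor d i) R).indicator fun x =>
    ⨅ y : {y : ∀ j, Factor d j // ∀ j, 0 < g j (y j)}, weight c Q g y i x

lemma conjugate_le_weight (g : ∀ i, Factor d i → ℝ≥0) (R : ℝ) (i : Fin n) {y : ∀ j, Factor d j}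
    (hy : ∀ j, 0 < g j (y j)) (x : Factor d i) : conjugate c Q g R i x ≤ weight c Q g y i x :=
  (Set.indicator_le_self' (fun _ _ => bot_le) x).trans
    (ciInf_le (OrderBot.bddBelow _)
      (⟨y, hy⟩ : {y : ∀ j, Factor d j // ∀ j, 0 < g j (y j)}))

lemma le_conjugate {g : ∀ i, Factor d i → ℝ≥0} (hne : ∀ j, ∃ y, 0 < g j y) {R : ℝ} {i : Fin n}
    {x : Factor d i} (hx : ‖x‖ ≤ R) {a : ℝ≥0}
    (h : ∀ y : ∀ j, Factor d j, (∀ j, 0 < g j (y j)) → a ≤ weight c Q g y i x) :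
    a ≤ conjugate c Q g R i x := by
  choose y hy using hne
  have : Nonempty {y : ∀ j, Factor d j // ∀ j, 0 < g j (y j)} := ⟨⟨y, hy⟩⟩
  rw [conjugate, Set.indicator_of_mem (by simpa using hx)]
  exact le_ciInf fun y => h y y.2

lemma conjugate_of_lt {g : ∀ i, Factor d i → ℝ≥0} {R : ℝ} {i : Fin n}
    {x : Factor d i} (hx : R < ‖x‖) : conjugate c Q g R i x = 0 :=
  Set.indicator_of_notMem (by simpa using hx) _

lemma weight_neg {g : ∀ i, Factor d i → ℝ≥0} (he : ∀ i x, g i (-x) = g i x)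
    (y : ∀ j, Factor d j) (i : Fin n) (x : Factor d i) :
    weight c Q g (-y) i (-x) = weight c Q g y i x := by
  have h1 : (WithLp.toLp 2 (Function.update (-y) i (-x)) : Total d) =
      -WithLp.toLp 2 (Function.update y i x) := by
    exact congrArg (WithLp.toLp 2) (Function.update_neg y i x)
  simp only [weight, h1, map_neg, inner_neg_neg, Pi.neg_apply, he]

lemma measurable_conjugate (hc : ∀ i, 0 < c i) (g : ∀ i, Factor d i → ℝ≥0) (R : ℝ) (i : Fin n) :
    Measurable (conjugate c Q g R i) := by
  refine Measurable.indicator ?_ Metric.isClosed_closedBall.measurableSet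
  have h : UpperSemicontinuous fun x =>
      ⨅ y : {y : ∀ j, Factor d j // ∀ j, 0 < g j (y j)}, weight c Q g y i x :=
    upperSemicontinuous_ciInf (fun _ => OrderBot.bddBelow _)
      fun y => (continuous_weight hc g y.1 i).upperSemicontinuous
  exact h.measurable

lemma isDensity_conjugate (hc : ∀ i, 0 < c i) {g : ∀ i, Factor d i → ℝ≥0}
    (hg : ∀ i, IsDensity (g i)) (hdom : Dominated c Q g) {R : ℝ} {i : Fin n}
    (hR : ∀ x, R < ‖x‖ → g i x = 0) :
    IsDensity (conjugate c Q g R i) ∧ ∀ x, g i x ≤ conjugate c Q g R i x := by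
  have hne : ∀ j, ∃ y, 0 < g j y := fun j =>
    exists_pos_of_lintegral_ne_zero (hg j).lintegral_ne_zero
  have hle : ∀ x, g i x ≤ conjugate c Q g R i x := fun x => by
    rcases lt_or_ge R ‖x‖ with h | h
    · rw [hR x h]; exact bot_le
    · exact le_conjugate hne h fun y hy => hdom.le_weight hc hy i x
  have hev : ∀ x, conjugate c Q g R i x ≤ conjugate c Q g R i (-x) := fun x => by
    rcases lt_or_ge R ‖x‖ with h | h
    · rw [conjugate_of_lt h]; exact bot_le
    · refine le_conjugate hne (by rwa [norm_neg]) fun y hy => ?_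
      have h1 := weight_neg (c := c) (Q := Q) (fun j => (hg j).even) (-y) i x
      rw [neg_neg] at h1
      rw [h1]
      exact conjugate_le_weight g R i (y := -y) (fun j => by
        rw [Pi.neg_apply, (hg j).even]; exact hy j) x
  refine ⟨⟨measurable_conjugate hc g R i, fun x => le_antisymm ?_ (hev x), ?_,
    ⟨R, fun x hx => conjugate_of_lt hx⟩, fun h0 => (hg i).lintegral_ne_zero ?_⟩, hle⟩
  · simpa using hev (-x)
  · choose y hy using hne
    obtain ⟨M, hM⟩ := exists_weight_le (Q := Q) hc g y i R
    refine ⟨M, fun x => ?_⟩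
    rcases lt_or_ge R ‖x‖ with h | h
    · rw [conjugate_of_lt h]; exact bot_le
    · exact (conjugate_le_weight g R i hy x).trans (hM x h)
  · exact le_antisymm ((lintegral_mono fun x => ENNReal.coe_le_coe.2 (hle x)).trans h0.le) bot_le

lemma dominated_update_conjugate (hc : ∀ i, 0 < c i) {g : ∀ i, Factor d i → ℝ≥0}
    (hne : ∀ j, ∃ y, 0 < g j y) (R : ℝ) (i : Fin n) :
    Dominated c Q (Function.update g i (conjugate c Q g R i)) := by
  intro x
  rw [← Finset.mul_prod_erase _ _ (Finset.mem_univ i), Function.update_self]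
  have h1 : ∏ j ∈ Finset.univ.erase i,
      Function.update g i (conjugate c Q g R i) j (x j) ^ c j =
        ∏ j ∈ Finset.univ.erase i, g j (x j) ^ c j :=
    Finset.prod_congr rfl fun j hj => by rw [Function.update_of_ne (Finset.ne_of_mem_erase hj)]
  rw [h1]
  rcases eq_or_ne (∏ j ∈ Finset.univ.erase i, g j (x j) ^ c j) 0 with h0 | h0
  · rw [h0, mul_zero]; exact bot_le
  obtain ⟨z, hz⟩ := hne i
  -- only the components `j ≠ i` of `y` enter `weight`; the `i`-th is chosen in the support of `g i`
  set y : ∀ j, Factor d j := Function.update (fun j => x j) i z with hy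
  have hyj : ∀ j ∈ Finset.univ.erase i, y j = x j := fun j hj =>
    Function.update_of_ne (Finset.ne_of_mem_erase hj) _ _
  have hpos : ∀ j, 0 < g j (y j) := by
    intro j
    rcases eq_or_ne j i with rfl | hj
    · rw [hy, Function.update_self]; exact hz
    · have hj' : j ∈ Finset.univ.erase i := by simp [hj]
      rw [hyj j hj', pos_iff_ne_zero]
      intro h2
      exact Finset.prod_ne_zero_iff.1 h0 j hj' (by rw [h2, NNReal.zero_rpow (hc j).ne'])
  have h2 := conjugate_le_weight (c := c) (Q := Q) g R i hpos (x i)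
  have h3 : (WithLp.toLp 2 (Function.update y i (x i)) : Total d) = x := by
    rw [hy, Function.update_idem]
    ext1 j
    simp
  rw [weight, h3, NNReal.le_rpow_inv_iff (hc i),
    Finset.prod_congr rfl fun j hj => by rw [hyj j hj], le_div_iff₀ (pos_iff_ne_zero.2 h0)] at h2
  exact h2

/-- If the `i`-th diagonal block of `Q` is nonnegative, `⟨x, Q x⟩` is convex in the `i`-th
component. -/
lemma cost_update_convex {i : Fin n}
    (hQ : ∀ v : Factor d i, 0 ≤ inner ℝ (WithLp.toLp 2 (Pi.single i v) : Total d)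
      (Q (WithLp.toLp 2 (Pi.single i v)))) (y : ∀ j, Factor d j) (x z : Factor d i) {s t : ℝ}
    (hs : 0 < s) (ht : 0 < t) (hst : s + t = 1) :
    inner ℝ (WithLp.toLp 2 (Function.update y i (s • x + t • z)) : Total d)
      (Q (WithLp.toLp 2 (Function.update y i (s • x + t • z)))) ≤
    s * inner ℝ (WithLp.toLp 2 (Function.update y i x) : Total d)
      (Q (WithLp.toLp 2 (Function.update y i x))) +
    t * inner ℝ (WithLp.toLp 2 (Function.update y i z) : Total d)
      (Q (WithLp.toLp 2 (Function.update y i z))) := by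
  have h1 : (WithLp.toLp 2 (Function.update y i (s • x + t • z)) : Total d) =
      s • WithLp.toLp 2 (Function.update y i x) + t • WithLp.toLp 2 (Function.update y i z) := by
    ext1 j
    rcases eq_or_ne j i with rfl | hj
    · simp
    · simp [Function.update_of_ne hj, ← add_smul, hst]
  have h2 : (WithLp.toLp 2 (Pi.single i (x - z)) : Total d) =
      WithLp.toLp 2 (Function.update y i x) - WithLp.toLp 2 (Function.update y i z) := by
    ext1 j
    rcases eq_or_ne j i with rfl | hj
    · simp
    · simp [Function.update_of_ne hj, Pi.single_eq_of_ne hj]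
  have h3 := hQ (x - z)
  rw [h2] at h3
  rw [h1]
  generalize (WithLp.toLp 2 (Function.update y i x) : Total d) = A at *
  generalize (WithLp.toLp 2 (Function.update y i z) : Total d) = B at *
  simp only [map_sub, map_add, map_smul, inner_sub_left, inner_sub_right, inner_add_left,
    inner_add_right, real_inner_smul_left, real_inner_smul_right] at h3 ⊢
  obtain rfl : t = 1 - s := by linarith
  nlinarith [mul_nonneg (mul_pos hs ht).le h3]

lemma conjugate_logConcave (hc : ∀ i, 0 < c i) {g : ∀ i, Factor d i → ℝ≥0}
    (hne : ∀ j, ∃ y, 0 < g j y) (R : ℝ) {i : Fin n}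
    (hQ : ∀ v : Factor d i, 0 ≤ inner ℝ (WithLp.toLp 2 (Pi.single i v) : Total d)
      (Q (WithLp.toLp 2 (Pi.single i v)))) (x z : Factor d i) {s t : ℝ}
    (hs : 0 < s) (ht : 0 < t) (hst : s + t = 1) :
    conjugate c Q g R i x ^ s * conjugate c Q g R i z ^ t ≤
      conjugate c Q g R i (s • x + t • z) := by
  rcases lt_or_ge R ‖x‖ with hx | hx
  · rw [conjugate_of_lt hx, NNReal.zero_rpow hs.ne', zero_mul]; exact bot_le
  rcases lt_or_ge R ‖z‖ with hz | hz
  · rw [conjugate_of_lt hz, NNReal.zero_rpow ht.ne', mul_zero]; exact bot_le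
  have hxz : ‖s • x + t • z‖ ≤ R := by
    have := convex_closedBall (0 : Factor d i) R (x := x) (by simpa using hx) (y := z)
      (by simpa using hz) hs.le ht.le hst
    simpa using this
  refine le_conjugate hne hxz fun y hy => ?_
  have h1 := NNReal.rpow_le_rpow (conjugate_le_weight (c := c) (Q := Q) g R i hy x) hs.le
  have h2 := NNReal.rpow_le_rpow (conjugate_le_weight (c := c) (Q := Q) g R i hy z) ht.le
  refine (mul_le_mul' h1 h2).trans ?_
  have hP : 0 < ∏ j ∈ Finset.univ.erase i, g j (y j) ^ c j :=
    Finset.prod_pos fun j _ => NNReal.rpow_pos (hy j)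
  simp only [weight]
  rw [← NNReal.rpow_mul, ← NNReal.rpow_mul, mul_comm _ s, mul_comm _ t, NNReal.rpow_mul,
    NNReal.rpow_mul, ← NNReal.mul_rpow]
  refine NNReal.rpow_le_rpow ?_ (inv_pos.2 (hc i)).le
  rw [NNReal.div_rpow, NNReal.div_rpow, div_mul_div_comm,
    ← NNReal.rpow_add_of_nonneg _ hs.le ht.le, hst, NNReal.rpow_one,
    ← Real.toNNReal_rpow_of_nonneg (Real.exp_pos _).le,
    ← Real.toNNReal_rpow_of_nonneg (Real.exp_pos _).le, ← Real.toNNReal_mul (by positivity),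
    ← Real.exp_mul, ← Real.exp_mul, ← Real.exp_add]
  gcongr
  linarith [cost_update_convex hQ y x z hs ht hst]

/-- If all diagonal blocks of `Q` are nonnegative, then densities that satisfy the constraint have
log-concave majorants that satisfy it: replace the `g_i` by their conjugates, one after the
other. -/
lemma exists_logConcave_majorant (hc : ∀ i, 0 < c i)
    (hQ : ∀ i, ∀ v : Factor d i, 0 ≤ inner ℝ (WithLp.toLp 2 (Pi.single i v) : Total d)
      (Q (WithLp.toLp 2 (Pi.single i v))))
    {g : ∀ i, Factor d i → ℝ≥0} (hg : ∀ i, IsDensity (g i)) (hdom : Dominated c Q g)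
    (S : Finset (Fin n)) :
    ∃ g' : ∀ i, Factor d i → ℝ≥0, (∀ i, IsDensity (g' i)) ∧ Dominated c Q g' ∧
      (∀ i x, g i x ≤ g' i x) ∧ ∀ i ∈ S, ∀ x y, ∀ s t : ℝ, 0 < s → 0 < t → s + t = 1 →
        g' i x ^ s * g' i y ^ t ≤ g' i (s • x + t • y) := by
  induction S using Finset.induction_on with
  | empty => exact ⟨g, hg, hdom, fun _ _ => le_rfl, by simp⟩
  | insert i S hi ih =>
    obtain ⟨g', h1, h2, h3, h4⟩ := ih
    have hne : ∀ j, ∃ y, 0 < g' j y := fun j =>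
      exists_pos_of_lintegral_ne_zero (h1 j).lintegral_ne_zero
    obtain ⟨R, hR⟩ := (h1 i).support
    obtain ⟨h5, h6⟩ := isDensity_conjugate hc h1 h2 hR
    refine ⟨Function.update g' i (conjugate c Q g' R i), fun j => ?_,
      dominated_update_conjugate hc hne R i, fun j x => ?_, fun j hj => ?_⟩
    · rcases eq_or_ne j i with rfl | hji
      · rwa [Function.update_self]
      · rw [Function.update_of_ne hji]; exact h1 j
    · rcases eq_or_ne j i with rfl | hji
      · rw [Function.update_self]; exact (h3 j x).trans (h6 x)
      · rw [Function.update_of_ne hji]; exact h3 j x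
    · rcases eq_or_ne j i with rfl | hji
      · rw [Function.update_self]
        exact fun x z s t hs ht hst => conjugate_logConcave hc hne R (hQ j) x z hs ht hst
      · rw [Function.update_of_ne hji]
        exact h4 j ((Finset.mem_insert.1 hj).resolve_left hji)

/-- If all diagonal blocks of `Q` are nonnegative, the entropy inequality for log-concave measures
implies the functional inequality. -/
lemma functionalInequality_of_logConcave (hc : ∀ i, 0 < c i)
    (hQ : ∀ i, ∀ v : Factor d i, 0 ≤ inner ℝ (WithLp.toLp 2 (Pi.single i v) : Total d)
      (Q (WithLp.toLp 2 (Pi.single i v)))) {D : ℝ}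
    (h : EntropyInequality c Q (logConcaveFamilies d) D) : FunctionalInequality c Q D := by
  refine functionalInequality_of_densities hc fun g hg hdom => ?_
  obtain ⟨g', h1, h2, h3, h4⟩ := exists_logConcave_majorant hc hQ hg hdom Finset.univ
  have h5 := sum_log_le_of_entropySum_le h1 h2
    (h _ ⟨fun i => ⟨(h1 i).memP, (h1 i).isNegInvariant⟩,
      fun i => (h1 i).isLogConcave (h4 i (Finset.mem_univ i))⟩)
  refine le_trans (Finset.sum_le_sum fun i _ => mul_le_mul_of_nonneg_left ?_ (hc i).le) h5
  exact Real.log_le_log (hg i).integral_pos (ENNReal.toReal_mono (h1 i).lintegral_ne_top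
    (lintegral_mono fun x => ENNReal.coe_le_coe.2 (h3 i x)))

end Conjugate

/-! ### From the functional to the entropy inequality: compactly supported measures -/

section Compact

variable {n : ℕ} {d : Fin n → ℕ} {c : Fin n → ℝ} {Q : Total d →ₗ[ℝ] Total d}

lemma sum_ereal_ne_bot {ι : Type*} (s : Finset ι) {a : ι → EReal} (h : ∀ i, a i ≠ ⊥) :
    ∑ i ∈ s, a i ≠ ⊥ := by
  classical
  induction s using Finset.induction_on with
  | empty => simp
  | insert i s hi ih => rw [Finset.sum_insert hi]; exact EReal.add_ne_bot_iff.2 ⟨h i, ih⟩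

lemma sum_log_le_of_functionalInequality (hc : ∀ i, 0 < c i) {D : ℝ}
    (h : FunctionalInequality c Q D) {g : ∀ i, Factor d i → ℝ≥0} (hg : ∀ i, IsDensity (g i))
    (hdom : Dominated c Q g) : ∑ i, c i * Real.log (∫⁻ y, g i y).toReal ≤ D := by
  have hexp : ∀ i x, EReal.exp (- -ENNReal.log (g i x)) = g i x := fun i x => by
    rw [neg_neg, ENNReal.exp_log]
  have hne : ∀ i x, -ENNReal.log (g i x) ≠ ⊥ := fun i x hx => by
    rw [EReal.neg_eq_bot_iff, ENNReal.log_eq_top_iff] at hx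
    exact ENNReal.coe_ne_top hx
  have h1 := h (fun i x => -ENNReal.log (g i x))
    (fun i => (ENNReal.measurable_log.comp (hg i).measurable.coe_nnreal_ennreal).neg) hne
    (fun i x => by rw [(hg i).even])
    (fun i => by simp_rw [hexp]; exact (hg i).lintegral_ne_top.lt_top) (fun x => ?_)
  · simp_rw [hexp] at h1
    rw [prod_rpow_eq_ofReal_exp (fun i => (hg i).lintegral_ne_zero)
      (fun i => (hg i).lintegral_ne_top), EReal.exp_coe,
      ENNReal.ofReal_le_ofReal_iff (Real.exp_pos _).le, Real.exp_le_exp] at h1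
    exact h1
  · by_cases hx : ∀ i, 0 < g i (x i)
    · have h2 : ∀ i, (c i : EReal) * -ENNReal.log (g i (x i)) =
          ((-(c i * Real.log (g i (x i))) : ℝ) : EReal) := fun i => by
        rw [ENNReal.log_pos_real (by simpa using (hx i).ne') ENNReal.coe_ne_top,
          ENNReal.coe_toReal, ← EReal.coe_neg, ← EReal.coe_mul, mul_neg]
      simp_rw [h2]
      rw [← coe_sum_ereal, EReal.coe_le_coe_iff, Finset.sum_neg_distrib]
      exact hdom.cost_le hx
    · push Not at hx
      obtain ⟨i, hi⟩ := hx
      have h2 : (c i : EReal) * -ENNReal.log (g i (x i)) = ⊤ := by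
        rw [nonpos_iff_eq_zero.1 hi]
        simpa using EReal.coe_mul_top_of_pos (hc i)
      rw [← Finset.add_sum_erase _ _ (Finset.mem_univ i), h2, EReal.top_add_of_ne_bot]
      · exact le_top
      · refine sum_ereal_ne_bot _ fun j => ?_
        rw [EReal.mul_ne_bot]
        have := hc j
        simp [hne j (x j), this.le]

/-- The entropy inequality for symmetric measures on balls. The potentials `φ_i` from Kantorovich
duality can be made even, since the cost is even; then `h(μ_i) ≤ ∫ f_i dμ_i + log ∫ e^{-f_i}` for
`f_i = φ_i / c_i` on the ball and `f_i = ∞` outside. -/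
lemma sum_entropy_le_of_support (hc : ∀ i, 0 < c i) {D : ℝ}
    (h : FunctionalInequality c Q D) {μ : ∀ i, Measure (Factor d i)}
    (hμ : ∀ i, MemP (μ i)) (hsymm : ∀ i, (μ i).IsNegInvariant)
    (hlog : ∀ i, Integrable (fun x => Real.log ((μ i).rnDeriv volume x).toReal) (μ i))
    {R : ℝ} (hR : 0 < R) (hsupp : ∀ i, ∀ᵐ x ∂(μ i), x ∈ Metric.closedBall (0 : Factor d i) R)
    {r : ℝ} (hr : ∀ γ ∈ couplings μ, ∫ x, inner ℝ x (Q x) ∂γ ≤ r) :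
    ∑ i, c i * -∫ x, Real.log ((μ i).rnDeriv volume x).toReal ∂(μ i) ≤ r + D := by
  have hprob := fun i => (hμ i).isProbabilityMeasure
  rcases isEmpty_or_nonempty (Fin n) with hempty | hnonempty
  · obtain ⟨γ, hγ⟩ := couplings_nonempty hprob
    have h1 := hr γ hγ
    have h2 : ∀ x : Total d, inner ℝ x (Q x) = (0 : ℝ) := fun x => by
      rw [Subsingleton.elim x 0, inner_zero_left]
    have h3 := sum_log_le_of_functionalInequality hc h (g := fun i _ => 1)
      (fun i => hempty.elim i) (fun x => by simp [h2])
    simp only [h2, integral_zero] at h1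
    simp only [Finset.univ_eq_empty, Finset.sum_empty] at h3 ⊢
    linarith
  set K : ∀ i, Set (Factor d i) := fun i => Metric.closedBall (0 : Factor d i) R with hK
  have hKm : ∀ i, MeasurableSet (K i) := fun i => Metric.isClosed_closedBall.measurableSet
  have hKcpt : ∀ i, CompactSpace (K i) := fun i =>
    isCompact_iff_compactSpace.1 (isCompact_closedBall _ _)
  set ν : ∀ i, Measure (K i) := fun i => (μ i).comap Subtype.val with hν
  have hνmap : ∀ i, (ν i).map Subtype.val = μ i := fun i => by
    rw [hν, map_comap_subtype_coe (hKm i), Measure.restrict_eq_self_of_ae_mem (hsupp i)]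
  have hνprob : ∀ i, IsProbabilityMeasure (ν i) := fun i => by
    refine ⟨?_⟩
    have h1 : (ν i).map Subtype.val Set.univ = 1 := by rw [hνmap]; exact measure_univ
    rwa [Measure.map_apply measurable_subtype_coe MeasurableSet.univ, Set.preimage_univ] at h1
  set incl : (∀ i, K i) → Total d := fun x => WithLp.toLp 2 fun i => (x i : Factor d i) with hincl
  have hinclc : Continuous incl := (PiLp.continuous_toLp 2 _).comp (by fun_prop)
  set F : C(∀ i, K i, ℝ) := ⟨fun x => inner ℝ (incl x) (Q (incl x)),
    (continuous_cost Q).comp hinclc⟩ with hF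
  obtain ⟨γ, hγp, hγm, hγF⟩ := exists_coupling_integral_eq_kantorovichDual ν F
  have hγ : γ.map incl ∈ couplings μ := by
    refine ⟨Measure.isProbabilityMeasure_map hinclc.measurable.aemeasurable, fun i => ?_⟩
    rw [Measure.map_map (measurable_proj i) hinclc.measurable, ← hνmap i, ← hγm i,
      Measure.map_map measurable_subtype_coe (measurable_pi_apply i)]
    rfl
  have hval : kantorovichDual ν F ≤ r := by
    rw [← hγF]
    refine le_of_eq_of_le ?_ (hr _ hγ)
    rw [integral_map hinclc.measurable.aemeasurable (continuous_cost Q).aestronglyMeasurable]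
    rfl
  refine le_of_forall_pos_lt_add fun ε hε => ?_
  obtain ⟨φ, hφF, hφ⟩ := exists_potentials_lt ν
    (lt_add_of_le_of_pos hval hε)
  choose Φ hΦ using fun i => (φ i).exists_restrict_eq
    (Metric.isClosed_closedBall (x := (0 : Factor d i)) (ε := R))
  have hΦφ : ∀ i (x : K i), Φ i x = φ i x := fun i x => by rw [← hΦ i]; rfl
  have hint : ∀ i, Integrable (Φ i) (μ i) := fun i => by
    rw [← hνmap i, integrable_map_measure (Φ i).continuous.aestronglyMeasurable
      measurable_subtype_coe.aemeasurable]
    exact (integrable_continuousMap ν i (φ i)).congr (Eventually.of_forall fun x => (hΦφ i x).symm)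
  have hintφ : ∀ i, ∫ x, Φ i x ∂(μ i) = ∫ x, φ i x ∂(ν i) := fun i => by
    rw [← hνmap i, integral_map measurable_subtype_coe.aemeasurable
      (Φ i).continuous.aestronglyMeasurable]
    exact integral_congr_ae (Eventually.of_forall fun x => hΦφ i x)
  have hintneg : ∀ i, Integrable (fun x => Φ i (-x)) (μ i) := fun i => (hint i).comp_neg
  set ψ : ∀ i, Factor d i → ℝ := fun i x => (Φ i x + Φ i (-x)) / (2 * c i) with hψ
  have hψc : ∀ i, Continuous (ψ i) := fun i =>
    ((Φ i).continuous.add ((Φ i).continuous.comp continuous_neg)).div_const _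
  have hψint : ∀ i, Integrable (ψ i) (μ i) := fun i => ((hint i).add (hintneg i)).div_const _
  have hψval : ∀ i, c i * ∫ x, ψ i x ∂(μ i) = ∫ x, φ i x ∂(ν i) := fun i => by
    rw [hψ, integral_div, integral_add (hint i) (hintneg i), integral_neg_eq_self (Φ i) (μ i),
      ← hintφ i]
    field_simp [(hc i).ne']
    ring
  set g : ∀ i, Factor d i → ℝ≥0 := fun i =>
    (K i).indicator fun x => Real.toNNReal (Real.exp (-ψ i x)) with hgdef
  have hgmem : ∀ i, ∀ x ∈ K i, g i x = Real.toNNReal (Real.exp (-ψ i x)) := fun i x hx =>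
    Set.indicator_of_mem hx _
  have hgnot : ∀ i, ∀ x ∉ K i, g i x = 0 := fun i x hx => Set.indicator_of_notMem hx _
  have hKneg : ∀ i (x : Factor d i), -x ∈ K i ↔ x ∈ K i := fun i x => by simp [hK]
  have hgd : ∀ i, IsDensity (g i) := fun i =>
    { measurable := by
        refine Measurable.indicator ?_ (hKm i)
        exact (Real.continuous_exp.comp (hψc i).neg).measurable.real_toNNReal
      even := fun x => by
        by_cases hx : x ∈ K i
        · rw [hgmem i x hx, hgmem i (-x) ((hKneg i x).2 hx)]
          simp only [hψ, neg_neg, add_comm]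
        · rw [hgnot i x hx, hgnot i (-x) fun h => hx ((hKneg i x).1 h)]
      bounded := by
        have hcont : Continuous fun x => Real.toNNReal (Real.exp (-ψ i x)) :=
          continuous_real_toNNReal.comp (Real.continuous_exp.comp (hψc i).neg)
        obtain ⟨M, hM⟩ := (isCompact_closedBall (0 : Factor d i) R).bddAbove_image
          hcont.continuousOn
        refine ⟨M, fun x => ?_⟩
        by_cases hx : x ∈ K i
        · rw [hgmem i x hx]; exact hM ⟨x, hx, rfl⟩
        · rw [hgnot i x hx]; exact bot_le
      support := ⟨R, fun x hx => hgnot i x (by simpa [hK] using hx)⟩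
      lintegral_ne_zero := by
        have hsup : (fun x => (g i x : ℝ≥0∞)).support = K i := by
          ext x
          by_cases hx : x ∈ K i
          · simp [hgmem i x hx, hx, Real.exp_pos]
          · simp [hgnot i x hx, hx]
        refine ((lintegral_pos_iff_support ?_).2 ?_).ne'
        · refine Measurable.coe_nnreal_ennreal (Measurable.indicator ?_ (hKm i))
          exact (Real.continuous_exp.comp (hψc i).neg).measurable.real_toNNReal
        · rw [hsup]
          exact Metric.measure_closedBall_pos _ _ hR }
  have hdom : Dominated c Q g := by
    intro x
    by_cases hx : ∀ i, x i ∈ K i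
    · have h1 : ∏ i, g i (x i) ^ c i = Real.toNNReal (Real.exp (-∑ i, c i * ψ i (x i))) := by
        rw [← Finset.sum_neg_distrib, Real.exp_sum,
          Real.toNNReal_prod_of_nonneg fun i _ => (Real.exp_pos _).le]
        refine Finset.prod_congr rfl fun i _ => ?_
        rw [hgmem i _ (hx i), ← Real.toNNReal_rpow_of_nonneg (Real.exp_pos _).le, ← Real.exp_mul]
        congr 2; ring
      rw [h1]
      gcongr
      -- the potentials dominate the cost both at `x` and at `-x`
      have h2 := hφF fun i => ⟨x i, hx i⟩
      have h3 := hφF fun i => ⟨-x i, (hKneg i _).2 (hx i)⟩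
      have h4 : incl (fun i => ⟨x i, hx i⟩) = x := rfl
      have h5 : incl (fun i => ⟨-x i, (hKneg i _).2 (hx i)⟩) = -x := rfl
      simp only [hF, ContinuousMap.coe_mk, h4, h5, map_neg, inner_neg_neg, ← hΦφ] at h2 h3
      have h6 : ∑ i, c i * ψ i (x i) = (∑ i, Φ i (x i) + ∑ i, Φ i (-x i)) / 2 := by
        rw [← Finset.sum_add_distrib, Finset.sum_div]
        refine Finset.sum_congr rfl fun i _ => ?_
        simp only [hψ]
        field_simp [(hc i).ne']
      rw [h6]
      linarith
    · push Not at hx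
      obtain ⟨i, hi⟩ := hx
      rw [Finset.prod_eq_zero (Finset.mem_univ i)
        (by rw [hgnot i _ hi, NNReal.zero_rpow (hc i).ne'])]
      exact bot_le
  have hlogg : ∀ i, ∀ᵐ x ∂(μ i), Real.log (g i x) = -ψ i x := fun i => by
    filter_upwards [hsupp i] with x hx
    rw [hgmem i x hx, Real.coe_toNNReal _ (Real.exp_pos _).le, Real.log_exp]
  have hgibbs : ∀ i, -∫ x, Real.log ((μ i).rnDeriv volume x).toReal ∂(μ i) ≤
      ∫ x, ψ i x ∂(μ i) + Real.log (∫⁻ x, g i x).toReal := fun i => by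
    have h1 := neg_integral_log_rnDeriv_le (hμ i).absolutelyContinuous (hlog i)
      (hgd i).measurable (by
        filter_upwards [hsupp i] with x hx
        rw [hgmem i x hx]
        exact Real.toNNReal_pos.2 (Real.exp_pos _))
      ((hψint i).neg.congr ((hlogg i).mono fun x hx => hx.symm))
      (hgd i).lintegral_ne_zero (hgd i).lintegral_ne_top
    rwa [integral_congr_ae (hlogg i), integral_neg, neg_neg] at h1
  calc ∑ i, c i * -∫ x, Real.log ((μ i).rnDeriv volume x).toReal ∂(μ i)
      ≤ ∑ i, c i * (∫ x, ψ i x ∂(μ i) + Real.log (∫⁻ x, g i x).toReal) :=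
        Finset.sum_le_sum fun i _ => mul_le_mul_of_nonneg_left (hgibbs i) (hc i).le
    _ = ∑ i, ∫ x, φ i x ∂(ν i) + ∑ i, c i * Real.log (∫⁻ x, g i x).toReal := by
        simp_rw [mul_add, Finset.sum_add_distrib, hψval]
    _ < r + ε + D :=
        add_lt_add_of_lt_of_le hφ (sum_log_le_of_functionalInequality hc h hgd hdom)
    _ = r + D + ε := by ring

end Compact

/-! ### From the functional to the entropy inequality: truncation -/

section Truncation

variable {m : ℕ} {μ : Measure (EuclideanSpace ℝ (Fin m))} {B : Set (EuclideanSpace ℝ (Fin m))}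

lemma integral_cond (f : EuclideanSpace ℝ (Fin m) → ℝ) :
    ∫ x, f x ∂(ProbabilityTheory.cond μ B) = (μ.real B)⁻¹ * ∫ x in B, f x ∂μ := by
  rw [ProbabilityTheory.cond, integral_smul_measure, ENNReal.toReal_inv, smul_eq_mul]
  rfl

lemma integrable_cond (h0 : μ B ≠ 0) {f : EuclideanSpace ℝ (Fin m) → ℝ} (hf : Integrable f μ) :
    Integrable f (ProbabilityTheory.cond μ B) :=
  hf.integrableOn.smul_measure (ENNReal.inv_ne_top.2 h0)

lemma cond_ac : ProbabilityTheory.cond μ B ≪ μ :=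
  (Measure.smul_absolutelyContinuous).trans Measure.restrict_le_self.absolutelyContinuous

lemma MemP.cond (h : MemP μ) (h0 : μ B ≠ 0) : MemP (ProbabilityTheory.cond μ B) := by
  have := h.isProbabilityMeasure
  exact ⟨ProbabilityTheory.cond_isProbabilityMeasure h0, cond_ac.trans h.absolutelyContinuous,
    integrable_cond h0 h.secondMoment⟩

lemma isNegInvariant_cond [μ.IsNegInvariant] (hB : MeasurableSet B) (hneg : Neg.neg ⁻¹' B = B) :
    (ProbabilityTheory.cond μ B).IsNegInvariant := by
  refine ⟨Measure.ext fun s hs => ?_⟩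
  rw [Measure.neg, Measure.map_apply measurable_neg hs, ProbabilityTheory.cond_apply hB,
    ProbabilityTheory.cond_apply hB]
  congr 1
  nth_rewrite 1 [← hneg]
  rw [← Set.preimage_inter, Measure.measure_preimage_neg]

lemma smul_cond_le {a : ℝ≥0} (ha : (a : ℝ≥0∞) ≤ μ B) :
    a • ProbabilityTheory.cond μ B ≤ μ := by
  refine le_trans ?_ (Measure.restrict_le_self (s := B))
  rw [Measure.le_iff]
  intro s _
  rw [ProbabilityTheory.cond, Measure.smul_apply, Measure.smul_apply, ENNReal.smul_def,
    smul_eq_mul, smul_eq_mul, ← mul_assoc]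
  refine mul_le_of_le_one_left' ?_
  calc (a : ℝ≥0∞) * (μ B)⁻¹ ≤ μ B * (μ B)⁻¹ := by gcongr
    _ ≤ 1 := ENNReal.mul_inv_le_one _

lemma log_rnDeriv_cond_ae [IsProbabilityMeasure μ] (hμ : μ ≪ volume) (hB : MeasurableSet B)
    (h0 : μ B ≠ 0) : ∀ᵐ x ∂(ProbabilityTheory.cond μ B),
      Real.log ((ProbabilityTheory.cond μ B).rnDeriv volume x).toReal =
        Real.log (μ.rnDeriv volume x).toReal - Real.log (μ.real B) := by
  have hac : ProbabilityTheory.cond μ B ≪ volume := cond_ac.trans hμ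
  have h1 : (ProbabilityTheory.cond μ B).rnDeriv volume =ᵐ[volume]
      (μ B)⁻¹ • (μ.restrict B).rnDeriv volume :=
    Measure.rnDeriv_smul_left_of_ne_top _ _ (ENNReal.inv_ne_top.2 h0)
  filter_upwards [hac h1, hac (Measure.rnDeriv_restrict μ volume hB),
    ProbabilityTheory.ae_cond_mem hB, cond_ac (rnDeriv_toReal_pos hμ)] with x h2 h3 h4 h5
  rw [h2, Pi.smul_apply, h3, Set.indicator_of_mem h4, smul_eq_mul, ENNReal.toReal_mul,
    ENNReal.toReal_inv]
  have h6 : 0 < (μ B).toReal := ENNReal.toReal_pos h0 (measure_ne_top _ _)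
  rw [Real.log_mul (inv_pos.2 h6).ne' (ne_of_gt h5), Real.log_inv]
  simp only [Measure.real]
  ring

lemma tendsto_setIntegral_closedBall {f : EuclideanSpace ℝ (Fin m) → ℝ} (hf : Integrable f μ) :
    Tendsto (fun k : ℕ => ∫ x in Metric.closedBall 0 k, f x ∂μ) atTop (𝓝 (∫ x, f x ∂μ)) := by
  have h := tendsto_setIntegral_of_monotone (μ := μ) (f := f)
    (s := fun k : ℕ => Metric.closedBall (0 : EuclideanSpace ℝ (Fin m)) k)
    (fun k => Metric.isClosed_closedBall.measurableSet)
    (fun k l hkl => Metric.closedBall_subset_closedBall (by exact_mod_cast hkl)) hf.integrableOn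
  rwa [Metric.iUnion_closedBall_nat, setIntegral_univ] at h

end Truncation

section General

variable {n : ℕ} {d : Fin n → ℕ} {c : Fin n → ℝ} {Q : Total d →ₗ[ℝ] Total d}

/-- If `a μ'_i ≤ μ_i`, a coupling of the `μ'_i` extends to a coupling of the `μ_i`: add the product
of the remainders. The cost of this product is bounded by the second moments. -/
lemma mul_integral_le_of_smul_le {C : ℝ}
    (hC : ∀ x : Total d, |inner ℝ x (Q x)| ≤ C * ∑ i, ‖x i‖ ^ 2)
    {μ μ' : ∀ i, Measure (Factor d i)} (hμ : ∀ i, MemP (μ i)) (hμ' : ∀ i, MemP (μ' i))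
    {a b : ℝ≥0} (hab : a + b = 1) (hb : 0 < b) (hle : ∀ i, a • μ' i ≤ μ i)
    {r : ℝ} (hr : ∀ γ ∈ couplings μ, ∫ x, inner ℝ x (Q x) ∂γ ≤ r)
    {γ' : Measure (Total d)} (hγ' : γ' ∈ couplings μ') :
    a * ∫ x, inner ℝ x (Q x) ∂γ' ≤
      r + C * ∑ i, (∫ x, ‖x‖ ^ 2 ∂(μ i) - a * ∫ x, ‖x‖ ^ 2 ∂(μ' i)) := by
  have hp := fun i => (hμ i).isProbabilityMeasure
  have hp' := fun i => (hμ' i).isProbabilityMeasure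
  set ν : ∀ i, Measure (Factor d i) := fun i => b⁻¹ • (μ i - a • μ' i) with hν
  have hsum : ∀ i, a • μ' i + b • ν i = μ i := fun i => by
    rw [hν, smul_smul, mul_inv_cancel₀ hb.ne', one_smul, add_comm,
      Measure.sub_add_cancel_of_le (hle i)]
  have hνp : ∀ i, IsProbabilityMeasure (ν i) := fun i => by
    refine ⟨?_⟩
    have h1 := congrArg (fun κ : Measure (Factor d i) => κ Set.univ) (hsum i)
    simp only [Measure.add_apply, Measure.smul_apply, measure_univ, ENNReal.smul_def,
      smul_eq_mul, mul_one] at h1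
    have h2 : (a : ℝ≥0∞) + b = 1 := by exact_mod_cast hab
    rw [← h2] at h1
    have h3 := (ENNReal.add_right_inj ENNReal.coe_ne_top).1 h1
    nth_rewrite 2 [← mul_one (b : ℝ≥0∞)] at h3
    exact (ENNReal.mul_right_inj (by exact_mod_cast hb.ne') ENNReal.coe_ne_top).1 h3
  have hνi : ∀ i, Integrable (fun x => ‖x‖ ^ 2) (ν i) := fun i => by
    have h1 : Integrable (fun x : Factor d i => ‖x‖ ^ 2) (b • ν i) :=
      (hμ i).secondMoment.mono_measure (by rw [← hsum i]; exact Measure.le_add_left le_rfl)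
    have h2 := h1.smul_measure_nnreal (c := b⁻¹)
    rwa [smul_smul, inv_mul_cancel₀ hb.ne', one_smul] at h2
  obtain ⟨κ, hκ⟩ := couplings_nonempty hνp
  have hγ : a • γ' + b • κ ∈ couplings μ := by
    have := hγ'.1
    have := hκ.1
    refine ⟨⟨?_⟩, fun i => ?_⟩
    · simp only [Measure.add_apply, Measure.smul_apply, measure_univ, ENNReal.smul_def,
        smul_eq_mul, mul_one]
      exact_mod_cast hab
    · rw [Measure.map_add _ _ (measurable_proj i), Measure.map_smul, Measure.map_smul, hγ'.2 i,
        hκ.2 i, hsum i]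
  have h1 := hr _ hγ
  have hi' := integrable_cost Q hγ' fun i => (hμ' i).secondMoment
  have hi := integrable_cost Q hκ hνi
  rw [integral_add_measure hi'.smul_measure_nnreal hi.smul_measure_nnreal,
    integral_smul_nnreal_measure, integral_smul_nnreal_measure] at h1
  simp only [NNReal.smul_def, smul_eq_mul] at h1
  have h2 : -(C * ∑ i, ∫ x, ‖x‖ ^ 2 ∂(ν i)) ≤ ∫ x, inner ℝ x (Q x) ∂κ := by
    have h3 : ∀ i, Integrable (fun x : Total d => ‖x i‖ ^ 2) κ := fun i =>
      integrable_comp_proj hκ i (hνi i)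
    have h4 : ∫ x, -(C * ∑ i, ‖x i‖ ^ 2) ∂κ ≤ ∫ x, inner ℝ x (Q x) ∂κ :=
      integral_mono ((integrable_finsetSum _ fun i _ => h3 i).const_mul C).neg hi
        fun x => neg_le_of_abs_le (hC x)
    rw [integral_neg, integral_const_mul, integral_finsetSum _ fun i _ => h3 i] at h4
    simp_rw [fun i => integral_comp_proj hκ i (hνi i).aestronglyMeasurable] at h4
    exact h4
  have h5 : ∀ i, ∫ x, ‖x‖ ^ 2 ∂(μ i) - a * ∫ x, ‖x‖ ^ 2 ∂(μ' i) = b * ∫ x, ‖x‖ ^ 2 ∂(ν i) := by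
    intro i
    have h6 := integral_add_measure (f := fun x : Factor d i => ‖x‖ ^ 2)
      ((hμ' i).secondMoment.smul_measure_nnreal (c := a))
      ((hνi i).smul_measure_nnreal (c := b))
    rw [hsum i, integral_smul_nnreal_measure, integral_smul_nnreal_measure] at h6
    simp only [NNReal.smul_def, smul_eq_mul] at h6
    rw [h6]; ring
  simp_rw [h5, ← Finset.mul_sum]
  have h7 := mul_le_mul_of_nonneg_left h2 b.2
  change (b : ℝ) * _ ≤ (b : ℝ) * _ at h7
  have h8 : C * (b * ∑ i, ∫ x, ‖x‖ ^ 2 ∂(ν i)) = -(b * -(C * ∑ i, ∫ x, ‖x‖ ^ 2 ∂(ν i))) := by ring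
  rw [h8]
  linarith

/-- The entropy inequality for arbitrary symmetric measures, from that for their restrictions to
balls of radius `k → ∞`. -/
lemma sum_entropy_le (hc : ∀ i, 0 < c i) {D : ℝ}
    (h : FunctionalInequality c Q D) {μ : ∀ i, Measure (Factor d i)}
    (hμ : ∀ i, MemP (μ i)) (hsymm : ∀ i, (μ i).IsNegInvariant)
    (hlog : ∀ i, Integrable (fun x => Real.log ((μ i).rnDeriv volume x).toReal) (μ i))
    {r : ℝ} (hr : ∀ γ ∈ couplings μ, ∫ x, inner ℝ x (Q x) ∂γ ≤ r) :
    ∑ i, c i * -∫ x, Real.log ((μ i).rnDeriv volume x).toReal ∂(μ i) ≤ r + D := by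
  have hp := fun i => (hμ i).isProbabilityMeasure
  obtain ⟨C, -, hC⟩ := exists_abs_cost_le Q
  set w : ∀ i, ℕ → ℝ := fun i k => (μ i).real (Metric.closedBall 0 k) with hw
  have hwlim : ∀ i, Tendsto (w i) atTop (𝓝 1) := fun i => by
    have := tendsto_setIntegral_closedBall (μ := μ i) (integrable_const (1 : ℝ))
    simpa [hw] using this
  -- the factor `k / (k + 1)` keeps `a k` below `1`, so that there is always a remainder
  set a : ℕ → ℝ := fun k => (k / (k + 1)) * ∏ i, w i k with ha
  have halim : Tendsto a atTop (𝓝 1) := by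
    have h1 := (tendsto_natCast_div_add_atTop (1 : ℝ)).mul
      (tendsto_finsetProd Finset.univ fun i _ => hwlim i)
    simpa using h1
  have hw1 : ∀ i k, w i k ≤ 1 := fun i k => measureReal_le_one
  have hw0 : ∀ i k, 0 ≤ w i k := fun i k => measureReal_nonneg
  have hL : ∀ i, Tendsto (fun k : ℕ => (w i k)⁻¹ *
      ∫ x in Metric.closedBall 0 k, Real.log ((μ i).rnDeriv volume x).toReal ∂(μ i) -
        Real.log (w i k)) atTop (𝓝 (∫ x, Real.log ((μ i).rnDeriv volume x).toReal ∂(μ i))) := by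
    intro i
    have h1 := ((hwlim i).inv₀ one_ne_zero).mul (tendsto_setIntegral_closedBall (hlog i))
    have h2 := (Real.continuousAt_log one_ne_zero).tendsto.comp (hwlim i)
    simpa using h1.sub h2
  have hS : ∀ i, Tendsto (fun k : ℕ => (w i k)⁻¹ * ∫ x in Metric.closedBall 0 k, ‖x‖ ^ 2 ∂(μ i))
      atTop (𝓝 (∫ x, ‖x‖ ^ 2 ∂(μ i))) := by
    intro i
    simpa using ((hwlim i).inv₀ one_ne_zero).mul
      (tendsto_setIntegral_closedBall (hμ i).secondMoment)
  have hlhs : Tendsto (fun k : ℕ => a k * ∑ i, c i * -((w i k)⁻¹ *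
      ∫ x in Metric.closedBall 0 k, Real.log ((μ i).rnDeriv volume x).toReal ∂(μ i) -
        Real.log (w i k))) atTop
      (𝓝 (1 * ∑ i, c i * -∫ x, Real.log ((μ i).rnDeriv volume x).toReal ∂(μ i))) :=
    halim.mul (tendsto_finsetSum _ fun i _ => (hL i).neg.const_mul _)
  have hrhs : Tendsto (fun k : ℕ => r + C * ∑ i, (∫ x, ‖x‖ ^ 2 ∂(μ i) -
      a k * ((w i k)⁻¹ * ∫ x in Metric.closedBall 0 k, ‖x‖ ^ 2 ∂(μ i))) + a k * D) atTop
      (𝓝 (r + C * ∑ i, (∫ x, ‖x‖ ^ 2 ∂(μ i) - 1 * ∫ x, ‖x‖ ^ 2 ∂(μ i)) + 1 * D)) :=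
    (tendsto_const_nhds.add ((tendsto_finsetSum _ fun i _ =>
      tendsto_const_nhds.sub (halim.mul (hS i))).const_mul C)).add (halim.mul_const D)
  have hmain : ∀ᶠ k : ℕ in atTop, a k * ∑ i, c i * -((w i k)⁻¹ *
      ∫ x in Metric.closedBall 0 k, Real.log ((μ i).rnDeriv volume x).toReal ∂(μ i) -
        Real.log (w i k)) ≤ r + C * ∑ i, (∫ x, ‖x‖ ^ 2 ∂(μ i) -
      a k * ((w i k)⁻¹ * ∫ x in Metric.closedBall 0 k, ‖x‖ ^ 2 ∂(μ i))) + a k * D := by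
    have hev : ∀ᶠ k in atTop, ∀ i, w i k ≠ 0 :=
      eventually_all.2 fun i => (hwlim i).eventually_ne one_ne_zero
    filter_upwards [hev, eventually_gt_atTop 0] with k hk hk0
    have hkr : (0 : ℝ) < k := by exact_mod_cast hk0
    have hB : ∀ i, MeasurableSet (Metric.closedBall (0 : Factor d i) k) := fun i =>
      Metric.isClosed_closedBall.measurableSet
    have hB0 : ∀ i, (μ i) (Metric.closedBall 0 k) ≠ 0 := fun i h0 =>
      hk i (by simp [hw, Measure.real, h0])
    set μ' : ∀ i, Measure (Factor d i) := fun i =>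
      ProbabilityTheory.cond (μ i) (Metric.closedBall 0 k) with hμ'def
    have hμ' : ∀ i, MemP (μ' i) := fun i => (hμ i).cond (hB0 i)
    have hp' := fun i => (hμ' i).isProbabilityMeasure
    have hlogae := fun i => log_rnDeriv_cond_ae (hμ i).absolutelyContinuous (hB i) (hB0 i)
    have hlog' : ∀ i, Integrable (fun x => Real.log ((μ' i).rnDeriv volume x).toReal) (μ' i) :=
      fun i => ((integrable_cond (hB0 i) (hlog i)).sub (integrable_const _)).congr
        ((hlogae i).mono fun x hx => hx.symm)
    have hint : ∀ i, ∫ x, Real.log ((μ' i).rnDeriv volume x).toReal ∂(μ' i) = (w i k)⁻¹ *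
        ∫ x in Metric.closedBall 0 k, Real.log ((μ i).rnDeriv volume x).toReal ∂(μ i) -
          Real.log (w i k) := fun i => by
      have := hp' i
      rw [integral_congr_ae (hlogae i), integral_sub (integrable_cond (hB0 i) (hlog i))
        (integrable_const _), integral_cond]
      simp only [integral_const, probReal_univ, smul_eq_mul, one_mul]
      rfl
    have hS' : ∀ i, ∫ x, ‖x‖ ^ 2 ∂(μ' i) =
        (w i k)⁻¹ * ∫ x in Metric.closedBall 0 k, ‖x‖ ^ 2 ∂(μ i) := fun i => integral_cond _
    obtain ⟨r', -, hr', hr'le⟩ := exists_couplingSup_eq_coe Q hp' fun i => (hμ' i).secondMoment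
    have h1 := sum_entropy_le_of_support hc h hμ' (fun i => isNegInvariant_cond (hB i)
      (by ext x; simp)) hlog' hkr (fun i => ProbabilityTheory.ae_cond_mem (hB i)) hr'
    simp_rw [hint] at h1
    have hprod0 : 0 < ∏ i, w i k := Finset.prod_pos fun i _ => (hw0 i k).lt_of_ne' (hk i)
    have hprod1 : ∏ i, w i k ≤ 1 := Finset.prod_le_one (fun i _ => hw0 i k) fun i _ => hw1 i k
    have hfrac : (k : ℝ) / (k + 1) < 1 := (div_lt_one (by positivity)).2 (by linarith)
    have ha0 : 0 < a k := by simp only [ha]; positivity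
    have ha1 : a k < 1 := mul_lt_one_of_nonneg_of_lt_one_left (by positivity) hfrac hprod1
    have haw : ∀ i, a k ≤ w i k := fun i => by
      have h2 : ∏ j, w j k ≤ w i k := by
        rw [← Finset.mul_prod_erase _ _ (Finset.mem_univ i)]
        exact mul_le_of_le_one_right (hw0 i k)
          (Finset.prod_le_one (fun j _ => hw0 j k) fun j _ => hw1 j k)
      exact (mul_le_of_le_one_left hprod0.le hfrac.le).trans h2
    have h3 : r' ≤ (r + C * ∑ i, (∫ x, ‖x‖ ^ 2 ∂(μ i) - a k * ∫ x, ‖x‖ ^ 2 ∂(μ' i))) / a k := by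
      refine hr'le _ fun γ' hγ' => ?_
      rw [le_div_iff₀ ha0, mul_comm]
      have h4 := mul_integral_le_of_smul_le hC hμ hμ' (a := (a k).toNNReal)
        (b := (1 - a k).toNNReal)
        (by rw [← Real.toNNReal_add ha0.le (by linarith), add_sub_cancel, Real.toNNReal_one])
        (Real.toNNReal_pos.2 (by linarith)) (fun i => smul_cond_le ?_) hr hγ'
      · rwa [Real.coe_toNNReal _ ha0.le] at h4
      · rw [← ENNReal.ofReal_toReal (measure_ne_top (μ i) (Metric.closedBall 0 k))]
        exact ENNReal.ofReal_le_ofReal (haw i)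
    rw [le_div_iff₀ ha0] at h3
    simp_rw [hS'] at h3
    have h4 := mul_le_mul_of_nonneg_left h1 ha0.le
    rw [mul_add, mul_comm _ r'] at h4
    linarith
  have hfin := le_of_tendsto_of_tendsto hlhs hrhs hmain
  simpa using hfin

lemma exists_couplingSup_of_symmetric {μ : ∀ i, Measure (Factor d i)}
    (hμ : μ ∈ symmetricFamilies d) :
    ∃ r : ℝ, couplingSup Q μ = r ∧ (∀ γ ∈ couplings μ, ∫ x, inner ℝ x (Q x) ∂γ ≤ r) ∧
      ∀ b : ℝ, (∀ γ ∈ couplings μ, ∫ x, inner ℝ x (Q x) ∂γ ≤ b) → r ≤ b :=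
  exists_couplingSup_eq_coe Q (fun i => (hμ i).1.isProbabilityMeasure)
    fun i => (hμ i).1.secondMoment

lemma entropyInequality_of_functionalInequality (hc : ∀ i, 0 < c i) {D : ℝ}
    (h : FunctionalInequality c Q D) : EntropyInequality c Q (symmetricFamilies d) D := by
  intro μ hμ
  by_cases hb : ∃ i, entropy (μ i) = ⊥
  · obtain ⟨i, hi⟩ := hb
    rw [entropySum, ← Finset.add_sum_erase _ _ (Finset.mem_univ i), hi,
      EReal.coe_mul_bot_of_pos (hc i), EReal.bot_add]
    exact bot_le
  push Not at hb
  have hlog := fun i => (hμ i).1.integrable_log_of_entropy_ne_bot (hb i)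
  obtain ⟨r, hr, hle, -⟩ := exists_couplingSup_of_symmetric (Q := Q) hμ
  rw [entropySum_eq_coe fun i => entropy_eq_coe (hlog i), hr, ← EReal.coe_add,
    EReal.coe_le_coe_iff]
  exact sum_entropy_le hc h (fun i => (hμ i).1) (fun i => (hμ i).2) hlog hle

end General

/-! ### Uniform measures on ellipsoids -/

section Ellipsoid

variable {m : ℕ} {S : EuclideanSpace ℝ (Fin m) →ₗ[ℝ] EuclideanSpace ℝ (Fin m)}

/-- The indicator function of the ellipsoid `{x | ‖S x‖ ≤ 1}`. -/
noncomputable def ellipsoid (S : EuclideanSpace ℝ (Fin m) →ₗ[ℝ] EuclideanSpace ℝ (Fin m)) :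
    EuclideanSpace ℝ (Fin m) → ℝ≥0 :=
  (S ⁻¹' Metric.closedBall 0 1).indicator 1

lemma ellipsoid_of_le {x : EuclideanSpace ℝ (Fin m)} (hx : ‖S x‖ ≤ 1) : ellipsoid S x = 1 :=
  Set.indicator_of_mem (by simpa using hx) _

lemma ellipsoid_of_lt {x : EuclideanSpace ℝ (Fin m)} (hx : 1 < ‖S x‖) : ellipsoid S x = 0 :=
  Set.indicator_of_notMem (by simpa using hx) _

lemma isDensity_ellipsoid (hS : LinearMap.ker S = ⊥) : IsDensity (ellipsoid S) := by
  have hcont : Continuous S := S.continuous_of_finiteDimensional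
  have hm : MeasurableSet (S ⁻¹' Metric.closedBall 0 1) :=
    (Metric.isClosed_closedBall.preimage hcont).measurableSet
  refine ⟨measurable_one.indicator hm, fun x => ?_, ⟨1, fun x => ?_⟩, ?_, ?_⟩
  · rcases le_or_gt ‖S x‖ 1 with h | h
    · rw [ellipsoid_of_le (by simpa using h), ellipsoid_of_le (by simpa using h)]
    · rw [ellipsoid_of_lt (by simpa using h), ellipsoid_of_lt (by simpa using h)]
  · rcases le_or_gt ‖S x‖ 1 with h | h
    · rw [ellipsoid_of_le h]
    · rw [ellipsoid_of_lt h]; exact bot_le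
  · obtain ⟨K, -, hK⟩ := S.exists_antilipschitzWith hS
    refine ⟨K, fun x hx => ellipsoid_of_lt ?_⟩
    have h1 := hK.le_mul_dist x 0
    rw [map_zero, dist_zero_right, dist_zero_right] at h1
    by_contra! h2
    have h3 : (K : ℝ) * ‖S x‖ ≤ K * 1 := by gcongr
    linarith
  · have h1 : (fun x => (ellipsoid S x : ℝ≥0∞)) = (S ⁻¹' Metric.closedBall 0 1).indicator 1 := by
      ext x
      rcases le_or_gt ‖S x‖ 1 with h | h
      · rw [ellipsoid_of_le h, Set.indicator_of_mem (by simpa using h)]; simp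
      · rw [ellipsoid_of_lt h, Set.indicator_of_notMem (by simpa using h)]; simp
    rw [h1, lintegral_indicator_one hm]
    refine (Measure.measure_pos_of_mem_nhds _ (x := 0)
      (hcont.continuousAt.preimage_mem_nhds ?_)).ne'
    rw [map_zero]
    exact Metric.closedBall_mem_nhds _ one_pos

lemma ellipsoid_logConcave (x y : EuclideanSpace ℝ (Fin m)) (s t : ℝ) (hs : 0 < s) (ht : 0 < t)
    (hst : s + t = 1) : ellipsoid S x ^ s * ellipsoid S y ^ t ≤ ellipsoid S (s • x + t • y) := by
  rcases lt_or_ge 1 ‖S x‖ with hx | hx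
  · rw [ellipsoid_of_lt hx, NNReal.zero_rpow hs.ne', zero_mul]; exact bot_le
  rcases lt_or_ge 1 ‖S y‖ with hy | hy
  · rw [ellipsoid_of_lt hy, NNReal.zero_rpow ht.ne', mul_zero]; exact bot_le
  have hxy : ‖S (s • x + t • y)‖ ≤ 1 := by
    have := convex_closedBall (0 : EuclideanSpace ℝ (Fin m)) 1 (x := S x) (by simpa using hx)
      (y := S y) (by simpa using hy) hs.le ht.le hst
    rw [map_add, map_smul, map_smul]
    simpa using this
  rw [ellipsoid_of_le hx, ellipsoid_of_le hy, ellipsoid_of_le hxy]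
  simp

lemma entropy_ellipsoid (hS : LinearMap.ker S = ⊥) : entropy (normalized (ellipsoid S)) =
    ((Real.log (∫⁻ x, ellipsoid S x).toReal : ℝ) : EReal) := by
  have h : ∀ x, Real.log (ellipsoid S x) = 0 := fun x => by
    rcases le_or_gt ‖S x‖ 1 with h | h
    · rw [ellipsoid_of_le h]; simp
    · rw [ellipsoid_of_lt h]; simp
  rw [(isDensity_ellipsoid hS).entropy_eq]
  simp [h]

/-- The map `S` sends the uniform measure on the ellipsoid to that on the ball. -/
lemma map_normalized_ellipsoid (hS : LinearMap.ker S = ⊥) :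
    (normalized (ellipsoid S)).map S = normalized (ellipsoid LinearMap.id) := by
  have hSm : Measurable S := S.continuous_of_finiteDimensional.measurable
  have hdet : LinearMap.det S ≠ 0 :=
    ((LinearMap.isUnit_iff_isUnit_det S).1 ((LinearMap.isUnit_iff_ker_eq_bot S).2 hS)).ne_zero
  have hmap := Measure.map_linearMap_addHaar_eq_smul_addHaar
    (volume : Measure (EuclideanSpace ℝ (Fin m))) hdet
  set k : ℝ≥0∞ := ENNReal.ofReal |(LinearMap.det S)⁻¹|
  have hk0 : k ≠ 0 := by simpa [k] using hdet
  have hk1 : k ≠ ∞ := ENNReal.ofReal_ne_top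
  have hid := isDensity_ellipsoid (m := m) (S := LinearMap.id) LinearMap.ker_id
  have hint : ∀ f : EuclideanSpace ℝ (Fin m) → ℝ≥0∞, Measurable f → ∀ s, MeasurableSet s →
      ∫⁻ x in S ⁻¹' s, f (S x) = k * ∫⁻ x in s, f x := fun f hf s hs => by
    rw [← setLIntegral_map hs hf hSm, hmap, Measure.restrict_smul, lintegral_smul_measure,
      smul_eq_mul]
  have hZ : ∫⁻ x, (ellipsoid S x : ℝ≥0∞) = k * ∫⁻ x : EuclideanSpace ℝ (Fin m),
      (ellipsoid LinearMap.id x : ℝ≥0∞) := by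
    have := hint _ hid.measurable.coe_nnreal_ennreal Set.univ MeasurableSet.univ
    rwa [Set.preimage_univ, setLIntegral_univ, setLIntegral_univ] at this
  have hcoe : ∀ (S' : EuclideanSpace ℝ (Fin m) →ₗ[ℝ] EuclideanSpace ℝ (Fin m)),
      LinearMap.ker S' = ⊥ → ∀ x, ((ellipsoid S' x / (∫⁻ y, ellipsoid S' y).toNNReal : ℝ≥0) : ℝ≥0∞)
        = ellipsoid S' x * (∫⁻ y, (ellipsoid S' y : ℝ≥0∞))⁻¹ := fun S' hS' x => by
    have h1 := isDensity_ellipsoid hS'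
    rw [ENNReal.coe_div (by
      rw [ENNReal.toNNReal_ne_zero]; exact ⟨h1.lintegral_ne_zero, h1.lintegral_ne_top⟩),
      ENNReal.coe_toNNReal h1.lintegral_ne_top, div_eq_mul_inv]
  refine Measure.ext fun s hs => ?_
  rw [Measure.map_apply hSm hs, normalized, normalized, withDensity_apply _ (hSm hs),
    withDensity_apply _ hs]
  simp_rw [hcoe S hS, hcoe _ LinearMap.ker_id]
  rw [lintegral_mul_const _ (isDensity_ellipsoid hS).measurable.coe_nnreal_ennreal,
    lintegral_mul_const _ hid.measurable.coe_nnreal_ennreal, hZ]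
  have h2 := hint _ hid.measurable.coe_nnreal_ennreal s hs
  change ∫⁻ x in S ⁻¹' s, (ellipsoid S x : ℝ≥0∞) = _ at h2
  rw [h2, ENNReal.mul_inv (Or.inl hk0) (Or.inl hk1), mul_mul_mul_comm,
    ENNReal.mul_inv_cancel hk0 hk1, one_mul]

lemma integral_inner_sq_pos {u : EuclideanSpace ℝ (Fin m)} (hu : u ≠ 0) :
    0 < ∫ x, inner ℝ u x ^ 2 ∂(normalized (ellipsoid (LinearMap.id :
      EuclideanSpace ℝ (Fin m) →ₗ[ℝ] EuclideanSpace ℝ (Fin m)))) := by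
  set ν := normalized (ellipsoid (LinearMap.id :
      EuclideanSpace ℝ (Fin m) →ₗ[ℝ] EuclideanSpace ℝ (Fin m))) with hν
  have hid := isDensity_ellipsoid (m := m) (S := LinearMap.id) LinearMap.ker_id
  have := hid.isProbabilityMeasure
  have hint : Integrable (fun x => inner ℝ u x ^ 2) ν := by
    refine (hid.integrable_norm_sq.const_mul (‖u‖ ^ 2)).mono'
      (by fun_prop) (Eventually.of_forall fun x => ?_)
    rw [Real.norm_eq_abs, abs_pow, ← mul_pow]
    gcongr
    exact abs_real_inner_le_norm u x
  rw [integral_pos_iff_support_of_nonneg (fun x => sq_nonneg _) hint]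
  have hnull : volume ((LinearMap.ker (innerₛₗ ℝ u) : Submodule ℝ (EuclideanSpace ℝ (Fin m))) :
      Set (EuclideanSpace ℝ (Fin m))) = 0 := by
    refine Measure.addHaar_submodule _ _ fun htop => hu ?_
    have h1 : u ∈ LinearMap.ker (innerₛₗ ℝ u) := htop ▸ Submodule.mem_top
    simpa using h1
  have hae : ∀ᵐ x ∂ν, x ∈ Function.support fun x => inner ℝ u x ^ 2 := by
    refine IsDensity.absolutelyContinuous.ae_le ?_
    filter_upwards [measure_eq_zero_iff_ae_notMem.1 hnull] with x hx h0
    exact hx (by simpa using h0)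
  rw [measure_eq_measure_of_null_sdiff (Set.subset_univ _) (by
    rw [← Set.compl_eq_univ_sdiff]; exact hae), measure_univ]
  exact one_pos

end Ellipsoid

/-! ### Diagonal blocks with a negative direction -/

section Negative

variable {n : ℕ} {d : Fin n → ℕ} {c : Fin n → ℝ} {Q : Total d →ₗ[ℝ] Total d}

/-- The contraction `x ↦ x - s / (1 + s) ⟨u, x⟩ u`. For a unit vector `u` it is the inverse of the
dilation by the factor `1 + s` in the direction `u`. -/
noncomputable def contraction {m : ℕ} (u : EuclideanSpace ℝ (Fin m)) (s : ℝ) :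
    EuclideanSpace ℝ (Fin m) →ₗ[ℝ] EuclideanSpace ℝ (Fin m) :=
  LinearMap.id - (s / (1 + s)) • (innerₛₗ ℝ u).smulRight u

section Contraction

variable {m : ℕ} {u : EuclideanSpace ℝ (Fin m)} {s : ℝ}

lemma contraction_apply (x : EuclideanSpace ℝ (Fin m)) :
    contraction u s x = x - (s / (1 + s)) • (inner ℝ u x : ℝ) • u := rfl

lemma inner_contraction (hu : ‖u‖ = 1) (hs : 0 ≤ s) (x : EuclideanSpace ℝ (Fin m)) :
    inner ℝ u (contraction u s x) = inner ℝ u x / (1 + s) := by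
  have h1 : (1 + s) ≠ 0 := by positivity
  rw [contraction_apply, inner_sub_right, real_inner_smul_right, real_inner_smul_right,
    real_inner_self_eq_norm_sq, hu]
  field_simp
  ring

lemma eq_contraction_add (hu : ‖u‖ = 1) (hs : 0 ≤ s) (x : EuclideanSpace ℝ (Fin m)) :
    x = contraction u s x + (s * inner ℝ u (contraction u s x)) • u := by
  rw [inner_contraction hu hs, contraction_apply, smul_smul, sub_add, ← sub_smul]
  have : s / (1 + s) * inner ℝ u x - s * (inner ℝ u x / (1 + s)) = 0 := by ring
  rw [this, zero_smul, sub_zero]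

lemma ker_contraction (hu : ‖u‖ = 1) (hs : 0 ≤ s) : LinearMap.ker (contraction u s) = ⊥ := by
  rw [LinearMap.ker_eq_bot']
  intro x hx
  rw [eq_contraction_add hu hs x, hx]
  simp

lemma norm_contraction_le (hu : ‖u‖ = 1) (hs : 0 ≤ s) (x : EuclideanSpace ℝ (Fin m)) :
    ‖contraction u s x‖ ≤ ‖x‖ := by
  have h1 : ‖x‖ ^ 2 = ‖contraction u s x‖ ^ 2 + (2 * s + s ^ 2) *
      inner ℝ u (contraction u s x) ^ 2 := by
    conv_lhs => rw [eq_contraction_add hu hs x]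
    rw [norm_add_sq_real, real_inner_smul_right, norm_smul, hu, real_inner_comm, mul_pow,
      Real.norm_eq_abs, sq_abs]
    ring
  refine le_of_sq_le_sq ?_ (norm_nonneg _)
  rw [h1]
  have : 0 ≤ (2 * s + s ^ 2) * inner ℝ u (contraction u s x) ^ 2 := by positivity
  linarith

end Contraction

/-- Under a coupling of the uniform measures on the ellipsoid elongated by `1 + s` in the direction
`u` of the `i`-th factor, and on the unit balls of the other factors, the cost is at most
`O(1 + s)` plus `s ^ 2` times a multiple of the cost of `u`. -/
lemma integral_cost_le_of_elongated {C : ℝ} (hC0 : 0 ≤ C)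
    (hC : ∀ x y : Total d, |inner ℝ x (Q y)| ≤ C * (‖x‖ * ‖y‖)) {i : Fin n} {u : Factor d i}
    (hu : ‖u‖ = 1) {s : ℝ} (hs : 0 ≤ s) {S : ∀ j, Factor d j →ₗ[ℝ] Factor d j}
    (hSi : S i = contraction u s) (hSj : ∀ j ≠ i, S j = LinearMap.id)
    (hker : ∀ j, LinearMap.ker (S j) = ⊥) {γ : Measure (Total d)}
    (hγ : γ ∈ couplings fun j => normalized (ellipsoid (S j))) :
    ∫ x, inner ℝ x (Q x) ∂γ ≤ C * n + 2 * C * √n * s +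
      (∫ y, inner ℝ u y ^ 2 ∂(normalized (ellipsoid LinearMap.id))) *
        inner ℝ (WithLp.toLp 2 (Pi.single i u) : Total d) (Q (WithLp.toLp 2 (Pi.single i u))) *
          s ^ 2 := by
  set e : Total d := WithLp.toLp 2 (Pi.single i u) with he
  have hne : ‖e‖ = 1 := (PiLp.norm_single 2 (Factor d) i u).trans hu
  have hd : ∀ j, IsDensity (ellipsoid (S j)) := fun j => isDensity_ellipsoid (hker j)
  have hγp := hγ.1
  have hSc : Continuous (S i) := (S i).continuous_of_finiteDimensional
  set f : Factor d i → ℝ := fun z => inner ℝ u (S i z) ^ 2 with hf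
  have hfi : Integrable f (normalized (ellipsoid (S i))) := by
    refine (hd i).integrable_norm_sq.mono' (by fun_prop) (Eventually.of_forall fun z => ?_)
    have h1 := abs_real_inner_le_norm u (S i z)
    have h2 := norm_contraction_le hu hs z
    rw [hu, one_mul] at h1
    rw [Real.norm_eq_abs, hf, abs_pow]
    rw [← hSi] at h2
    exact pow_le_pow_left₀ (abs_nonneg _) (h1.trans h2) 2
  have hfval : ∫ z, f z ∂(normalized (ellipsoid (S i))) =
      ∫ y, inner ℝ u y ^ 2 ∂(normalized (ellipsoid LinearMap.id)) := by
    rw [← map_normalized_ellipsoid (hker i), integral_map hSc.measurable.aemeasurable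
      (by fun_prop)]
  have hbound : ∀ᵐ x ∂γ, inner ℝ x (Q x) ≤
      C * n + 2 * C * √n * s + f (x i) * inner ℝ e (Q e) * s ^ 2 := by
    have hball : ∀ j, ∀ᵐ z ∂(normalized (ellipsoid (S j))), ‖S j z‖ ≤ 1 := fun j => by
      filter_upwards [(hd j).ae_pos] with z hz
      by_contra! h
      exact hz.ne' (ellipsoid_of_lt h)
    filter_upwards [ae_all_iff.2 fun j => ae_comp_proj hγ j (hball j)] with x hx
    set t : ℝ := inner ℝ u (S i (x i)) with ht
    set y : Total d := WithLp.toLp 2 fun j => S j (x j) with hy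
    have hxy : x = y + (s * t) • e := by
      ext1 j
      rcases eq_or_ne j i with rfl | hj
      · simp only [hy, he, PiLp.add_apply, PiLp.smul_apply, Pi.single_eq_same]
        rw [ht, hSi]
        exact eq_contraction_add hu hs (x j)
      · simp [hy, he, hSj j hj, Pi.single_eq_of_ne hj]
    have hny : ‖y‖ ≤ √n := by
      rw [PiLp.norm_eq_of_L2]
      refine Real.sqrt_le_sqrt ?_
      calc ∑ j, ‖y j‖ ^ 2 ≤ ∑ j : Fin n, (1 : ℝ) :=
            Finset.sum_le_sum fun j _ => pow_le_one₀ (norm_nonneg _) (hx j)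
        _ = n := by simp
    have ht1 : |t| ≤ 1 := by
      have := abs_real_inner_le_norm u (S i (x i))
      rw [hu, one_mul] at this
      exact this.trans (hx i)
    have h1 : inner ℝ y (Q y) ≤ C * n := by
      refine (le_abs_self _).trans ((hC y y).trans ?_)
      rw [← Real.mul_self_sqrt (Nat.cast_nonneg n)]
      gcongr
    have h2 : t * (inner ℝ y (Q e) + inner ℝ e (Q y)) ≤ 2 * C * √n := by
      have h3 : |inner ℝ y (Q e) + inner ℝ e (Q y)| ≤ 2 * C * √n := by
        refine (abs_add_le _ _).trans ((add_le_add (hC y e) (hC e y)).trans ?_)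
        rw [hne, mul_one, one_mul]
        have := mul_le_mul_of_nonneg_left hny hC0
        linarith
      refine (le_abs_self _).trans ?_
      rw [abs_mul]
      exact (mul_le_of_le_one_left (abs_nonneg _) ht1).trans h3
    have h4 : inner ℝ x (Q x) = inner ℝ y (Q y) + t * (inner ℝ y (Q e) + inner ℝ e (Q y)) * s +
        f (x i) * inner ℝ e (Q e) * s ^ 2 := by
      have hft : f (x i) = t ^ 2 := rfl
      rw [hft]
      conv_lhs => rw [hxy]
      simp only [map_add, map_smul, inner_add_left, inner_add_right, real_inner_smul_left,
        real_inner_smul_right]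
      ring
    rw [h4]
    have h5 := mul_le_mul_of_nonneg_right h2 hs
    linarith
  have hfγ := integrable_comp_proj hγ i hfi
  have hfin : Integrable (fun x : Total d => f (x i) * inner ℝ e (Q e) * s ^ 2) γ :=
    (hfγ.mul_const _).mul_const _
  refine (integral_mono_ae (integrable_cost Q hγ fun j => (hd j).integrable_norm_sq)
    ((integrable_const _).add hfin) hbound).trans_eq ?_
  rw [integral_add' (integrable_const _) hfin, integral_mul_const, integral_mul_const,
    integral_comp_proj hγ i hfi.aestronglyMeasurable, hfval]
  simp

lemma normalized_mem_logConcaveFamilies {S : ∀ j, Factor d j →ₗ[ℝ] Factor d j}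
    (hS : ∀ j, LinearMap.ker (S j) = ⊥) :
    (fun j => normalized (ellipsoid (S j))) ∈ logConcaveFamilies d :=
  ⟨fun j => ⟨(isDensity_ellipsoid (hS j)).memP, (isDensity_ellipsoid (hS j)).isNegInvariant⟩,
    fun j => (isDensity_ellipsoid (hS j)).isLogConcave ellipsoid_logConcave⟩

/-- If the entropy inequality holds for log-concave measures with a finite constant, the diagonal
blocks of `Q` are nonnegative: otherwise, elongating one of the measures in a negative direction
sends the supremum over couplings to `-∞`, while the entropies stay bounded below. -/
lemma nonneg_of_entropyInequality (hc : ∀ i, 0 < c i) {D : ℝ}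
    (h : EntropyInequality c Q (logConcaveFamilies d) D) (i : Fin n) (v : Factor d i) :
    0 ≤ inner ℝ (WithLp.toLp 2 (Pi.single i v) : Total d)
      (Q (WithLp.toLp 2 (Pi.single i v))) := by
  by_contra! hneg
  have hv : v ≠ 0 := by
    rintro rfl
    simp at hneg
  set u : Factor d i := ‖v‖⁻¹ • v with hudef
  have hu : ‖u‖ = 1 := norm_smul_inv_norm hv
  have hQu : inner ℝ (WithLp.toLp 2 (Pi.single i u) : Total d)
      (Q (WithLp.toLp 2 (Pi.single i u))) < 0 := by
    have h1 : (WithLp.toLp 2 (Pi.single i u) : Total d) =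
        ‖v‖⁻¹ • WithLp.toLp 2 (Pi.single i v) := by
      rw [hudef, Pi.single_smul, WithLp.toLp_smul]
    rw [h1, map_smul, real_inner_smul_left, real_inner_smul_right, ← mul_assoc]
    exact mul_neg_of_pos_of_neg (mul_pos (by positivity) (by positivity)) hneg
  obtain ⟨C, hC0, hC⟩ := exists_abs_inner_le Q
  set κ : ℝ := ∫ y, inner ℝ u y ^ 2 ∂(normalized (ellipsoid LinearMap.id))
  have hκ : 0 < κ := integral_inner_sq_pos fun h0 => by simp [h0] at hu
  set q : ℝ := inner ℝ (WithLp.toLp 2 (Pi.single i u) : Total d)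
    (Q (WithLp.toLp 2 (Pi.single i u)))
  set V : ℝ := ∑ j, c j * Real.log (∫⁻ x : Factor d j, ellipsoid LinearMap.id x).toReal
  have key : ∀ s : ℝ, 0 ≤ s → V ≤ C * n + 2 * C * √n * s + κ * q * s ^ 2 + D := by
    intro s hs
    set S : ∀ j, Factor d j →ₗ[ℝ] Factor d j :=
      Function.update (fun j => LinearMap.id) i (contraction u s) with hS
    have hSi : S i = contraction u s := Function.update_self _ _ _
    have hSj : ∀ j ≠ i, S j = LinearMap.id := fun j hj => Function.update_of_ne hj _ _
    have hker : ∀ j, LinearMap.ker (S j) = ⊥ := fun j => by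
      rcases eq_or_ne j i with rfl | hj
      · rw [hSi]; exact ker_contraction hu hs
      · rw [hSj j hj]; exact LinearMap.ker_id
    have hnorm : ∀ j x, ‖S j x‖ ≤ ‖x‖ := fun j x => by
      rcases eq_or_ne j i with rfl | hj
      · rw [hSi]; exact norm_contraction_le hu hs x
      · rw [hSj j hj]; rfl
    have hd : ∀ j, IsDensity (ellipsoid (S j)) := fun j => isDensity_ellipsoid (hker j)
    obtain ⟨r, hr, -, hle⟩ := exists_couplingSup_eq_coe Q (fun j => (hd j).isProbabilityMeasure)
      (fun j => (hd j).integrable_norm_sq)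
    have h1 := h _ (normalized_mem_logConcaveFamilies hker)
    rw [entropySum_eq_coe fun j => entropy_ellipsoid (hker j), hr, ← EReal.coe_add,
      EReal.coe_le_coe_iff] at h1
    have h2 := hle _ fun γ hγ => integral_cost_le_of_elongated hC0 hC hu hs hSi hSj hker hγ
    have h3 : V ≤ ∑ j, c j * Real.log (∫⁻ x, ellipsoid (S j) x).toReal := by
      refine Finset.sum_le_sum fun j _ => mul_le_mul_of_nonneg_left ?_ (hc j).le
      refine Real.log_le_log (isDensity_ellipsoid LinearMap.ker_id).integral_pos
        (ENNReal.toReal_mono (hd j).lintegral_ne_top (lintegral_mono fun x => ?_))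
      rw [ENNReal.coe_le_coe]
      rcases le_or_gt ‖x‖ 1 with hx | hx
      · rw [ellipsoid_of_le ((hnorm j x).trans hx)]
        exact Set.indicator_le_self _ _ x
      · rw [ellipsoid_of_lt (by simpa using hx)]; exact bot_le
    linarith
  have ha : 0 < -(κ * q) := by have := mul_neg_of_pos_of_neg hκ hQu; linarith
  have hb : 0 ≤ 2 * C * √n := by positivity
  -- a quadratic polynomial in `s` with negative leading coefficient is not bounded below
  set b : ℝ := 2 * C * √n + |C * n + D - V|
  set s : ℝ := b / -(κ * q) + 1 with hs
  have hb0 : 0 ≤ b := by positivity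
  have hs1 : 1 ≤ s := by rw [hs]; linarith [div_nonneg hb0 ha.le]
  have h1 := key s (by linarith)
  have h2 : -(κ * q) * s = b + -(κ * q) := by
    rw [hs, mul_add, mul_div_cancel₀ _ ha.ne', mul_one]
  have h3 : κ * q * s ^ 2 = -((b + -(κ * q)) * s) := by rw [← h2]; ring
  have h4 : (C * n + D - V) ≤ |C * n + D - V| * s :=
    (le_abs_self _).trans (le_mul_of_one_le_right (abs_nonneg _) hs1)
  have h5 : 0 < -(κ * q) * s := mul_pos ha (by linarith)
  have h6 : b * s = 2 * C * √n * s + |C * n + D - V| * s := by ring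
  rw [h3] at h1
  linarith

end Negative

/-! ### Sharp constants -/

section Sharp

variable {n : ℕ} {d : Fin n → ℕ} {c : Fin n → ℝ} {Q : Total d →ₗ[ℝ] Total d}

lemma entropyInequality_top : EntropyInequality c Q (symmetricFamilies d) ⊤ := by
  intro μ hμ
  obtain ⟨r, hr, -⟩ := exists_couplingSup_of_symmetric (Q := Q) hμ
  rw [hr, EReal.coe_add_top]
  exact le_top

lemma EntropyInequality.logConcave {D : EReal}
    (h : EntropyInequality c Q (symmetricFamilies d) D) :
    EntropyInequality c Q (logConcaveFamilies d) D := fun μ hμ => h μ hμ.1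

/-- The functional inequality and the entropy inequalities for symmetric and for symmetric
log-concave measures hold with the same constants. -/
lemma functionalInequality_tfae (hc : ∀ i, 0 < c i) {D : EReal} (hD : D ≠ ⊥) :
    [FunctionalInequality c Q D, EntropyInequality c Q (symmetricFamilies d) D,
      EntropyInequality c Q (logConcaveFamilies d) D].TFAE := by
  induction D with
  | bot => exact absurd rfl hD
  | top =>
    refine List.tfae_of_forall True _ ?_
    simp only [List.mem_cons, List.not_mem_nil, or_false, forall_eq_or_imp, forall_eq, iff_true]
    refine ⟨fun f _ _ _ _ _ => ?_, entropyInequality_top, entropyInequality_top.logConcave⟩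
    rw [EReal.exp_top]
    exact le_top
  | coe D =>
    tfae_have 1 → 2 := entropyInequality_of_functionalInequality hc
    tfae_have 2 → 3 := EntropyInequality.logConcave
    tfae_have 3 → 1 := fun h =>
      functionalInequality_of_logConcave hc (nonneg_of_entropyInequality hc h) h
    tfae_finish

lemma admissibleConstants_logConcave (hc : ∀ i, 0 < c i) :
    admissibleConstants c Q (logConcaveFamilies d) =
      admissibleConstants c Q (symmetricFamilies d) := by
  ext D
  exact and_congr_right fun hD => (functionalInequality_tfae hc hD).out 2 1

/-- The admissible constants are the upper bounds of the entropy deficits. -/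
lemma admissibleConstants_eq_Ici :
    admissibleConstants c Q (logConcaveFamilies d) =
      Set.Ici (sSup ((fun μ => entropySum c μ - couplingSup Q μ) '' logConcaveFamilies d)) := by
  have hiff : ∀ D : EReal, EntropyInequality c Q (logConcaveFamilies d) D ↔
      sSup ((fun μ => entropySum c μ - couplingSup Q μ) '' logConcaveFamilies d) ≤ D := by
    intro D
    rw [sSup_le_iff, Set.forall_mem_image]
    refine forall₂_congr fun μ hμ => ?_
    obtain ⟨r, hr, -⟩ := exists_couplingSup_of_symmetric (Q := Q) hμ.1
    rw [hr, EReal.sub_le_iff_le_add (by simp) (by simp), add_comm]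
  ext D
  rw [Set.mem_Ici, ← hiff]
  refine ⟨fun h => h.2, fun h => ⟨?_, h⟩⟩
  -- the uniform measures on the unit balls have finite entropy, so that `⊥` is not admissible
  rintro rfl
  have hker : ∀ j, LinearMap.ker (LinearMap.id : Factor d j →ₗ[ℝ] Factor d j) = ⊥ := fun j =>
    LinearMap.ker_id
  have h1 := h _ (normalized_mem_logConcaveFamilies hker)
  rw [entropySum_eq_coe fun j => entropy_ellipsoid (hker j), EReal.add_bot, le_bot_iff] at h1
  exact EReal.coe_ne_bot _ h1

lemma sharpSymmetricConstant_eq_sSup (hc : ∀ i, 0 < c i) :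
    sharpSymmetricConstant c Q =
      sSup ((fun μ => entropySum c μ - couplingSup Q μ) '' logConcaveFamilies d) := by
  rw [sharpSymmetricConstant, ← admissibleConstants_logConcave hc, admissibleConstants_eq_Ici,
    csInf_Ici]

end Sharp

end EntropicDuality

theorem mainTheorem6 {n : ℕ} (d : Fin n → ℕ) (c : Fin n → ℝ) (hc : ∀ i, 0 < c i)
    (Q : EntropicDuality.Total d →ₗ[ℝ] EntropicDuality.Total d) (hQ : Q.IsSymmetric) :
    (∀ D : EReal, D ≠ ⊥ →
      (EntropicDuality.FunctionalInequality c Q D ↔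
        EntropicDuality.EntropyInequality c Q (EntropicDuality.symmetricFamilies d) D)) ∧
    IsLeast
      (EntropicDuality.admissibleConstants c Q (EntropicDuality.symmetricFamilies d))
      (EntropicDuality.sharpSymmetricConstant c Q) ∧
    IsLeast
      (EntropicDuality.admissibleConstants c Q (EntropicDuality.logConcaveFamilies d))
      (EntropicDuality.sharpSymmetricConstant c Q) ∧
    ∃ μ : ℕ → ∀ i, MeasureTheory.Measure (EntropicDuality.Factor d i),
      (∀ k, μ k ∈ EntropicDuality.logConcaveFamilies d) ∧
      Filter.Tendsto
        (fun k => EntropicDuality.entropySum c (μ k) - EntropicDuality.couplingSup Q (μ k))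
        Filter.atTop (nhds (EntropicDuality.sharpSymmetricConstant c Q)) := by
  have hleast : IsLeast
      (EntropicDuality.admissibleConstants c Q (EntropicDuality.logConcaveFamilies d))
      (EntropicDuality.sharpSymmetricConstant c Q) := by
    rw [EntropicDuality.sharpSymmetricConstant_eq_sSup hc,
      EntropicDuality.admissibleConstants_eq_Ici]
    exact isLeast_Ici
  refine ⟨fun D hD => (EntropicDuality.functionalInequality_tfae hc hD).out 0 1, ?_, hleast, ?_⟩
  · rwa [← EntropicDuality.admissibleConstants_logConcave hc]
  · have hne : (EntropicDuality.logConcaveFamilies d).Nonempty :=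
      ⟨_, EntropicDuality.normalized_mem_logConcaveFamilies
        (S := fun _ => LinearMap.id) fun _ => LinearMap.ker_id⟩
    obtain ⟨a, -, ha, hmem⟩ := exists_seq_tendsto_sSup
      (hne.image fun μ => EntropicDuality.entropySum c μ - EntropicDuality.couplingSup Q μ)
      (OrderTop.bddAbove _)
    choose μ hμ hμa using hmem
    refine ⟨μ, hμ, ?_⟩
    rw [EntropicDuality.sharpSymmetricConstant_eq_sSup hc]
    exact ha.congr fun k => (hμa k).symm
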